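/- **Vertex weights.** Fix $n\ge 1$. For $A\in\{0,1\}^n$ write $|A|=\sum_k A_k$ and $A_{(i,n]}=\sum_{k>i}A_k$; let $e_1,\dots,e_n$ be the unit vectors and $e_0=0$. For $A,C\in\{0,1\}^n$ and $b,d\in\{0,1,\dots,n\}$ put $\tilde L^{(s)}_{z,q}(A,b;C,d)=0$ unless $A+e_b=C+e_d$, in which case $$\tilde L^{(s)}_{z,q}(A,b;C,d)=\frac1{1-sz}\cdot\begin{cases}1-q^{|A|}sz & b=d=0,\\ (-1)^{A_i}(s-q^{A_i}z)\,q^{A_{(i,n]}}s & b=d=i\ge1,\\ (q^{A_i}-1)\,q^{A_{(i,n]}}sz & b=0,\ d=i\ge1,\\ 1-s^2q^{|A|} & b\ge1,\ d=0,\\ (q^{A_d}-1)\,q^{A_{(d,n]}}sz & 1\le b<d,\\ (q^{A_d}-1)\,q^{A_{(d,n]}}s^2 & 1\le d<b.\end{cases}$$ Put $\tilde M^{(s)}_{z,q}(A,b;C,d)=\tilde L^{(1/s)}_{1/z,1/q}(A,b;C,d)$; this is the weight of a vertex with bottom edge $A$, right edge $b$, top edge $C$ and left edge $d$. **The functions $g_\Delta$.**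 For $m\ge1$, a *colour sequence* of level $m$ is a vector $i^{[m]}\in[1,n]^{nm}$ in which every colour $k\in[1,n]$ occurs exactly $m$ times. Given such an $i^{[m]}$, consider the lattice with rows $1,\dots,nm$ (from bottom to top) and columns $0,1,2,\dots$ (from left to right), with weight $\tilde M^{(s)}_{x_a,q}$ at each vertex of row $a$, with left boundary label $i_a$ and right boundary label $0$ in row $a$, with bottom labels $(1,\dots,1)$ in the columns $0,\dots,m-1$ and $0$ in all further columns, and with all top labels $0$. (Columns $\ge m$ are empty, each with weight $1$.) Let $P(s)$ be its partition function: the sum over all labellings of the inner edges of the product of the vertex weights. Then $$g^{i^{[m]}}_\Delta(m^n;x_1,\dots,x_{nm};s)=(-s)^{n\binom m2}P(s),$$ a rational function of $s$, and $g^{i^{[m]}}_\Delta(m^n;\vec Q^{[m]})$ denotes its value at $s=0$ for $$(x_1,\dots,x_{nm})=\vec Q^{[m]}=(q^{n-1},\dots,q^{n-1},\dots,q,\dots,q,1,\dots,1),$$ each power of $q$ being repeated $m$ times. **Interlacing and $\Psi$.** Let $i=i^{[m]}$, $j=j^{[m+1]}$ be colour sequences of levels $m$, $m+1$. Along a horizontal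 line place, from left to right, $n$ bundles of arrows; the $k$-th bundle is $j_{(k-1)(m+1)+1},\,i_{(k-1)m+1},\,j_{(k-1)(m+1)+2},\dots,\,i_{km},\,j_{k(m+1)}$. One path of each colour $1,\dots,n$ enters the line at its right end and moves to the left; at an arrow $i_a$ a path of that colour joins the line from below; at an arrow $j_b$ a path of that colour leaves the line at the top; no path leaves at the left end. Write $i\prec j$ if this is possible with no colour occurring twice at any point of the line. In that case let $\Psi(i;j)=q^{\xi(i;j)}$, where $\xi(i;j)$ is the number of pairs of an arrow $i_a$ and a colour $c>i_a$ whose path passes along the line above the arrow $i_a$. (If $i\not\prec j$, put $\Psi(i;j)=0$.) **Theorem.** Let $n,m\ge1$, let $q$ be an element of a field with $q\ne0$ and $q^k\neq1$ for $1\le k\le n$ (for instance an indeterminate), and let $i^{[m]}$ be a colour sequence of level $m$. Then the rational functions of $s$ that define $g^{i^{[m]}}_\Delta(m^n;\vec Q^{[m]})$ and all $g^{j^{[m+1]}}_\Delta((m+1)^n;\vec Q^{[m+1]})$ are regular at $s=0$, and $$g^{i^{[m]}}_\Delta\big(m^n;\vec Q^{[m]}\big)=\sum_{j^{[m+1]}}\Theta\big(i^{[m]};j^{[m+1]}\big)\,g^{j^{[m+1]}}_\Delta\big((m+1)^n;\vec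 Q^{[m+1]}\big),$$ where the sum is over all colour sequences $j^{[m+1]}$ of level $m+1$ and the coefficients are the rational functions of $q$ $$\Theta\big(i^{[m]};j^{[m+1]}\big)=\mathbf 1_{i^{[m]}\prec j^{[m+1]}}\,(-1)^n\,q^{\binom{nm+n+1}2-\binom{nm+1}2}\,\frac{(1-q)^{nm}}{(q;q)_n^{2m+1}}\;\Psi\big(i^{[m]};j^{[m+1]}\big)\Big|_{q\mapsto q^{-1}},\qquad (q;q)_n=\prod_{k=1}^n(1-q^k).$$ -/

import Mathlib

/-! Fermionic vertex model: colours are `Fin n`, ordered as usual (the colours `1, …, n`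
become `0, …, n - 1`).  A horizontal edge carries `none` (no path) or `some c`.  A vertical edge carries a set of
colours, that is, a binary string in `{0,1}^n`. -/

namespace FermionicVertex

variable {n : ℕ}

/-- The entry `A_c` of the binary string of `A`. -/
def occ (A : Finset (Fin n)) (c : Fin n) : ℕ := if c ∈ A then 1 else 0

/-- The entry at `c` of the vector `e_b`, with `e_none = 0`. -/
def unitVec (b : Option (Fin n)) (c : Fin n) : ℕ := if b = some c then 1 else 0

/-- `A_{c+1} + ⋯ + A_n`, the number of colours of `A` that exceed `c`. -/
def above (A : Finset (Fin n)) (c : Fin n) : ℕ := (A.filter fun a => c < a).card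

/-- Conservation of colours at a vertex: `A + e_b = C + e_d`. -/
def Conserved (A : Finset (Fin n)) (b : Option (Fin n)) (C : Finset (Fin n))
    (d : Option (Fin n)) : Prop :=
  ∀ c : Fin n, occ A c + unitVec b c = occ C c + unitVec d c

instance (A : Finset (Fin n)) (b : Option (Fin n)) (C : Finset (Fin n)) (d : Option (Fin n)) :
    Decidable (Conserved A b C d) := by
  unfold Conserved; infer_instance

/-- The values of the `L`-weights when colours are conserved (`A` bottom, `b` left, `d` right; the
top is then determined). -/
def LTable {F : Type*} [Field F] (q s z : F) (A : Finset (Fin n)) :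
    Option (Fin n) → Option (Fin n) → F
  | none, none => (1 - q ^ A.card * s * z) / (1 - s * z)
  | none, some i => (q ^ occ A i - 1) * q ^ above A i * s * z / (1 - s * z)
  | some _, none => (1 - s ^ 2 * q ^ A.card) / (1 - s * z)
  | some b, some d =>
      if b = d then (-1) ^ occ A b * (s - q ^ occ A b * z) * q ^ above A b * s / (1 - s * z)
      else if b < d then (q ^ occ A d - 1) * q ^ above A d * s * z / (1 - s * z)
      else (q ^ occ A d - 1) * q ^ above A d * s ^ 2 / (1 - s * z)

/-- The weight of an `L`-vertex with bottom `A`, left `b`, top `C`, right `d`. -/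
def LWeight {F : Type*} [Field F] (q s z : F) (A : Finset (Fin n)) (b : Option (Fin n))
    (C : Finset (Fin n)) (d : Option (Fin n)) : F :=
  if Conserved A b C d then LTable q s z A b d else 0

/-- The weight of an `M`-vertex with bottom `A`, right `b`, top `C`, left `d` (paths travel from
right to left): the `L`-weight with all parameters inverted. -/
def MWeight {F : Type*} [Field F] (q s z : F) (A : Finset (Fin n)) (b : Option (Fin n))
    (C : Finset (Fin n)) (d : Option (Fin n)) : F :=
  LWeight q⁻¹ s⁻¹ z⁻¹ A b C d

/-- The row operator of leftward `M`-vertices on the columns `0, …, N - 1`, with left boundary label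
`i` and right boundary label `j`.  The entry at `(A, B)` is the one-row partition function with
bottom labels `A` and top labels `B`; `h k` is the label of the horizontal edge to the left of
column `k`. -/
def rowM {F : Type*} [Field F] (q s x : F) (N : ℕ) (i j : Option (Fin n)) :
    Matrix (Fin N → Finset (Fin n)) (Fin N → Finset (Fin n)) F :=
  Matrix.of fun A B => ∑ h : Fin (N + 1) → Option (Fin n),
    if h 0 = i ∧ h (Fin.last N) = j then
      ∏ k : Fin N, MWeight q s x (A k) (h k.succ) (B k) (h k.castSucc)
    else 0

/-- A (strict, nonnegative) `lam`-coloured composition: for each colour `c`, a set of `lam c`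
distinct nonnegative integers. -/
structure ColouredComposition (n : ℕ) (lam : Fin n → ℕ) where
  parts : Fin n → Finset ℕ
  card_parts : ∀ c, (parts c).card = lam c

/-- The composition `Δ` of colour profile `m^n`, with parts `0, 1, …, m - 1` in every colour. -/
def delta (n m : ℕ) : ColouredComposition n (fun _ => m) where
  parts := fun _ => Finset.range m
  card_parts := fun _ => Finset.card_range m

namespace ColouredComposition

variable {lam : Fin n → ℕ}

/-- `|μ|`, the sum of all parts. -/
def size (μ : ColouredComposition n lam) : ℕ := ∑ c, ∑ k ∈ μ.parts c, k

/-- The least number `N` such that all parts are smaller than `N`. -/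
def width (μ : ColouredComposition n lam) : ℕ :=
  Finset.univ.sup fun c => (μ.parts c).sup fun k => k + 1

/-- The binary string `A(k)` of `μ` in column `k`. -/
def column (μ : ColouredComposition n lam) (k : ℕ) : Finset (Fin n) :=
  Finset.univ.filter fun c => k ∈ μ.parts c

end ColouredComposition

/-- The partition function `⟨μ| B_{σ 1}(x_1) ⋯ B_{σ p}(x_p) |∅⟩` on the columns `0, …, N - 1`: row
`a`, counted from the bottom, has parameter `x a`, left label `σ a`, right label `none`; the bottom
is `μ` and the top is empty. -/
def gPartition {F : Type*} [Field F] (q s : F) {lam : Fin n → ℕ} (N : ℕ)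
    (μ : ColouredComposition n lam) {p : ℕ} (σ : Fin p → Fin n) (x : Fin p → F) : F :=
  (List.ofFn fun a : Fin p => rowM q s (x a) N (some (σ a)) none).prod
    (fun k => μ.column k) (fun _ => ∅)

/-- An empty vertex has weight 1, unless `s z = 1`, in which case the vertex weights are undefined. -/
theorem MWeight_empty {F : Type*} [Field F] (q s z : F) (h : 1 - s⁻¹ * z⁻¹ ≠ 0)
    (C : Finset (Fin n)) (d : Option (Fin n)) :
    MWeight q s z ∅ none C d = if C = ∅ ∧ d = none then 1 else 0 := by
  have hc : Conserved ∅ none C d ↔ C = ∅ ∧ d = none := by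
    constructor
    · intro hC
      have key : ∀ c, c ∉ C ∧ d ≠ some c := by
        intro c
        have := hC c
        simp only [occ, unitVec, Finset.notMem_empty, if_false, reduceCtorEq] at this
        by_cases h1 : c ∈ C <;> by_cases h2 : d = some c <;> simp [h1, h2] at this ⊢
      refine ⟨Finset.eq_empty_of_forall_notMem fun c => (key c).1, ?_⟩
      cases d with
      | none => rfl
      | some c => exact absurd rfl (key c).2
    · rintro ⟨rfl, rfl⟩ c
      rfl
  unfold MWeight LWeight
  by_cases h' : C = ∅ ∧ d = none
  · rw [if_pos (hc.2 h'), if_pos h', h'.2]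
    simp only [LTable, Finset.card_empty, pow_zero, one_mul]
    exact div_self h
  · rw [if_neg (fun h'' => h' (hc.1 h'')), if_neg h']

theorem rowM_snoc {F : Type*} [Field F] (q s x : F) (h : 1 - s⁻¹ * x⁻¹ ≠ 0) (N : ℕ)
    (i : Option (Fin n)) (A B : Fin N → Finset (Fin n)) (e : Finset (Fin n)) :
    rowM q s x (N + 1) i none (Fin.snoc (α := fun _ => Finset (Fin n)) A ∅)
      (Fin.snoc (α := fun _ => Finset (Fin n)) B e) =
      if e = ∅ then rowM q s x N i none A B else 0 := by
  simp only [rowM, Matrix.of_apply]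
  rw [← (Fin.snocEquiv fun _ : Fin (N + 1 + 1) => Option (Fin n)).sum_comp,
    Fintype.sum_prod_type, Finset.sum_eq_single none]
  · by_cases he : e = ∅
    · rw [if_pos he]
      refine Finset.sum_congr rfl fun g _ => ?_
      have h0 : (Fin.snocEquiv fun _ : Fin (N + 1 + 1) => Option (Fin n)) (none, g) 0 = g 0 := by
        exact Fin.snoc_castSucc (α := fun _ : Fin (N + 1 + 1) => Option (Fin n)) none g 0
      have h1 : (Fin.snocEquiv fun _ : Fin (N + 1 + 1) => Option (Fin n)) (none, g)
          (Fin.last (N + 1)) = none := by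
        exact Fin.snoc_last (α := fun _ : Fin (N + 1 + 1) => Option (Fin n)) none g
      rw [h0, h1, Fin.prod_univ_castSucc]
      simp only [Fin.snocEquiv, Equiv.coe_fn_mk, Fin.snoc_castSucc, Fin.snoc_last,
        Fin.succ_castSucc, Fin.succ_last, MWeight_empty q s x h, he, true_and, and_true]
      by_cases h2 : g (Fin.last N) = none <;> simp [h2]
    · rw [if_neg he]
      refine Finset.sum_eq_zero fun g _ => ?_
      rw [Fin.prod_univ_castSucc]
      simp [Fin.snocEquiv, Fin.snoc_castSucc, Fin.snoc_last, MWeight_empty q s x h, he,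
        Fin.succ_last]
  · intro o _ ho
    refine Finset.sum_eq_zero fun g _ => ?_
    rw [if_neg]
    rintro ⟨-, h1⟩
    apply ho
    rw [← h1]
    exact (Fin.snoc_last (α := fun _ : Fin (N + 1 + 1) => Option (Fin n)) o g).symm
  · intro h1
    exact absurd (Finset.mem_univ _) h1

theorem prod_rowM_snoc {F : Type*} [Field F] (q s : F) (N : ℕ) (l : List (Fin n × F))
    (h : ∀ a ∈ l, 1 - s⁻¹ * a.2⁻¹ ≠ 0) (A B : Fin N → Finset (Fin n)) (e : Finset (Fin n)) :
    (l.map fun a => rowM q s a.2 (N + 1) (some a.1) none).prod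
      (Fin.snoc (α := fun _ => Finset (Fin n)) A ∅) (Fin.snoc (α := fun _ => Finset (Fin n)) B e) =
      if e = ∅ then (l.map fun a => rowM q s a.2 N (some a.1) none).prod A B else 0 := by
  induction l generalizing A with
  | nil =>
      simp only [List.map_nil, List.prod_nil, Matrix.one_apply, Fin.snoc_inj]
      by_cases he : e = ∅
      · simp [he]
      · simp [he, Ne.symm he]
  | cons a l ih =>
      simp only [List.map_cons, List.prod_cons, Matrix.mul_apply]
      rw [← (Fin.snocEquiv fun _ : Fin (N + 1) => Finset (Fin n)).sum_comp,
        Fintype.sum_prod_type, Finset.sum_eq_single ∅]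
      · simp only [Fin.snocEquiv, Equiv.coe_fn_mk]
        have hl : ∀ b ∈ l, 1 - s⁻¹ * b.2⁻¹ ≠ 0 := fun b hb => h b (by simp [hb])
        have ha := h a (by simp)
        by_cases he : e = ∅
        · rw [if_pos he]
          refine Finset.sum_congr rfl fun g _ => ?_
          rw [rowM_snoc q s a.2 ha, if_pos rfl, ih hl, if_pos he]
        · rw [if_neg he]
          refine Finset.sum_eq_zero fun g _ => ?_
          rw [ih hl, if_neg he, mul_zero]
      · intro o _ ho
        refine Finset.sum_eq_zero fun g _ => ?_
        simp only [Fin.snocEquiv, Equiv.coe_fn_mk]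
        rw [rowM_snoc q s a.2 (h a (by simp)), if_neg ho, zero_mul]
      · intro h1
        exact absurd (Finset.mem_univ _) h1

/-- The partition function does not depend on the cutoff, as long as all parts of `μ` are to its
left (and all vertex weights are defined). -/
theorem gPartition_stable {F : Type*} [Field F] (q s : F) {lam : Fin n → ℕ}
    (μ : ColouredComposition n lam) {p : ℕ} (σ : Fin p → Fin n) (x : Fin p → F)
    (h : ∀ a, 1 - s⁻¹ * (x a)⁻¹ ≠ 0) (N : ℕ) (hN : μ.width ≤ N) :
    gPartition q s N μ σ x = gPartition q s μ.width μ σ x := by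
  induction N, hN using Nat.le_induction with
  | base => rfl
  | succ N hN ih =>
      rw [← ih]
      have hcol : μ.column N = ∅ := by
        refine Finset.filter_eq_empty_iff.2 fun c _ hc => ?_
        have h1 : N + 1 ≤ (μ.parts c).sup fun k => k + 1 :=
          Finset.le_sup (f := fun k => k + 1) hc
        have h2 : ((μ.parts c).sup fun k => k + 1) ≤ μ.width :=
          Finset.le_sup (f := fun c => (μ.parts c).sup fun k => k + 1) (Finset.mem_univ c)
        omega
      have hA : (fun k : Fin (N + 1) => μ.column k) =
          Fin.snoc (α := fun _ => Finset (Fin n)) (fun k : Fin N => μ.column k) ∅ := by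
        funext k
        refine Fin.lastCases ?_ (fun k => ?_) k
        · rw [Fin.snoc_last]; exact hcol
        · rw [Fin.snoc_castSucc]; rfl
      have hB : (fun _ : Fin (N + 1) => (∅ : Finset (Fin n))) =
          Fin.snoc (α := fun _ => Finset (Fin n)) (fun _ : Fin N => ∅) ∅ := by
        funext k
        refine Fin.lastCases ?_ (fun k => ?_) k
        · rw [Fin.snoc_last]
        · rw [Fin.snoc_castSucc]
      have hl : ∀ M : ℕ, (List.ofFn fun a : Fin p => rowM q s (x a) M (some (σ a)) none) =
          (List.ofFn fun a : Fin p => (σ a, x a)).map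
            fun a => rowM q s a.2 M (some a.1) none := by
        intro M
        rw [List.map_ofFn]
        rfl
      unfold gPartition
      rw [hA, hB, hl, hl, prod_rowM_snoc, if_pos rfl]
      intro a ha
      obtain ⟨b, rfl⟩ := (List.mem_ofFn' _ _).1 ha
      exact h b

/-- The function `g_μ^σ(lam; x_1, …, x_p; s)`.  The half-infinite lattice is cut off after the last
column in which `μ` has a part; every column to the right of it is empty and has weight 1, see
`gPartition_stable`. -/
def gFun {F : Type*} [Field F] (q s : F) {lam : Fin n → ℕ}
    (μ : ColouredComposition n lam) {p : ℕ} (σ : Fin p → Fin n) (x : Fin p → F) : F :=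
  (-s) ^ μ.size * gPartition q s μ.width μ σ x

/-- `g_μ^σ(lam; x_1, …, x_p; s)` as a rational function of the indeterminate `s`. -/
noncomputable def gRat {K : Type*} [Field K] (q : K) {lam : Fin n → ℕ}
    (μ : ColouredComposition n lam) {p : ℕ} (σ : Fin p → Fin n) (x : Fin p → K) : RatFunc K :=
  gFun (RatFunc.C q) RatFunc.X μ σ (fun a => RatFunc.C (x a))

/-- The value of `g_μ^σ(lam; x_1, …, x_p; s)` at `s = 0`. -/
noncomputable def gZero {K : Type*} [Field K] (q : K) {lam : Fin n → ℕ}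
    (μ : ColouredComposition n lam) {p : ℕ} (σ : Fin p → Fin n) (x : Fin p → K) : K :=
  (gRat q μ σ x).eval (RingHom.id K) 0

/-- The specialization `(q^{n-1}, …, q^{n-1}, …, q, …, q, 1, …, 1)`, each power `m` times. -/
def qSpec {K : Type*} [Field K] (q : K) (n m : ℕ) : Fin (n * m) → K :=
  fun a => q ^ (n - 1 - (a : ℕ) / m)

/-- `i` is a colour sequence in which every colour occurs exactly `m` times. -/
abbrev IsColourSeq (m : ℕ) (i : Fin (n * m) → Fin n) : Prop :=
  ∀ c : Fin n, (Finset.univ.filter fun a => i a = c).card = m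

/-- A vertical arrow attached to the thick horizontal line: a colour entering from below, or a
colour leaving at the top. -/
inductive Arrow (n : ℕ) where
  | enter (c : Fin n)
  | leave (c : Fin n)

/-- The arrows attached to the line, listed from left to right: for `k = 1, …, n` the `k`-th bundle
`j_{(k-1)(m+1)+1}, i_{(k-1)m+1}, j_{(k-1)(m+1)+2}, …, i_{km}, j_{k(m+1)}`. -/
def arrows {m : ℕ} (i : Fin (n * m) → Fin n) (j : Fin (n * (m + 1)) → Fin n) : List (Arrow n) :=
  (List.finRange n).flatMap fun k =>
    Arrow.leave (j (finProdFinEquiv (k, 0))) ::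
      (List.finRange m).flatMap fun a =>
        [Arrow.enter (i (finProdFinEquiv (k, a))), Arrow.leave (j (finProdFinEquiv (k, a.succ)))]

/-- Trace the coloured paths along the line from right to left, starting with one path of each
colour at the right end.  The result is `none` if at some point a colour would occur twice on the
line, or a colour has to leave that is not on the line; otherwise it is the set of colours that come
out at the left end, together with the number of events in which a path of colour `c` passes above
an entering colour `i` with `c > i`. -/
def trace : List (Arrow n) → Option (Finset (Fin n) × ℕ)
  | [] => some (Finset.univ, 0)
  | Arrow.leave c :: l =>
      (trace l).bind fun S => if c ∈ S.1 then some (S.1.erase c, S.2) else none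
  | Arrow.enter c :: l =>
      (trace l).bind fun S => if c ∈ S.1 then none else some (insert c S.1, S.2 + above S.1 c)

/-- The interlacing relation `i ≺ j`: the diagram is admissible, and no colour comes out at the left
end. -/
def Interlace {m : ℕ} (i : Fin (n * m) → Fin n) (j : Fin (n * (m + 1)) → Fin n) : Prop :=
  ∃ N : ℕ, trace (arrows i j) = some (∅, N)

/-- The one-row partition function `Ψ(i; j)`: the diagram is determined by `i` and `j`, and each of
its events has weight `q`. -/
def Psi {K : Type*} [Field K] (q : K) {m : ℕ} (i : Fin (n * m) → Fin n)
    (j : Fin (n * (m + 1)) → Fin n) : K :=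
  match trace (arrows i j) with
  | none => 0
  | some S => if S.1 = ∅ then q ^ S.2 else 0

/-- The `q`-Pochhammer symbol `(a; q)_k`. -/
def qPoch {K : Type*} [Field K] (a q : K) (k : ℕ) : K := ∏ r ∈ Finset.range k, (1 - a * q ^ r)

open Classical in
/-- The coefficient `Θ(i; j)`. -/
noncomputable def Theta {K : Type*} [Field K] (q : K) {m : ℕ} (i : Fin (n * m) → Fin n)
    (j : Fin (n * (m + 1)) → Fin n) : K :=
  (if Interlace i j then 1 else 0) * (-1) ^ n *
    q ^ ((n * m + n + 1).choose 2 - (n * m + 1).choose 2) *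
    ((1 - q) ^ (n * m) / qPoch q q n ^ (2 * m + 1)) * Psi q⁻¹ i j

end FermionicVertex

/-! Put p = q⁻¹. At s = 0 a row with left label i and parameter x becomes an operator B_i(x), and
g_Δ on m columns is, up to a power of q, the entry of a product of such operators between the state
with all columns full and the empty state. The leftmost factor is the bottom row. A Yang–Baxter
relation, checked at one column and carried through all columns, gives the quadratic relations
`ExchangeRelations`.

For a set T of k colours let W_k(T) be the sum, over all orders of T, of the products of row
operators with parameters p^(k-1) t, …, p t, t (`wordSum` along `ladder`). At ratio p the relations
degenerate to B_i(py) B_j(y) = p B_j(py) B_i(y) for i < j, and B_i(py) B_i(y) = 0. Hence a single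
choice of the first colour already recovers the whole sum: (1 + p + ⋯ + p^k) B_i(p^k t) W_k(T∖i) =
p^a W_{k+1}(T), where a counts the colours of T above i (`smul_wordSum_ladder`). Away from ratio p
the sum is symmetric in the parameters, so also W_{k+1}(T) = ∑_c W_k(T∖c) B_c(p^k t)
(`wordSum_ladder_succ`).

Take t = 1, and let T be the set of colours present at a point of the line that defines Ψ. Going
along the line from left to right, the second identity absorbs each leaving arrow into W, and the
first one releases each entering arrow to the left of W, using up exactly its weight in Ψ. Summing
over j turns the products for j, weighted by Ψ, into a constant times the product for i followed by
W_n of all colours (`sum_wordSum_mul_line`).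

This still lives on m + 1 columns, with n additional rows on top. To remove them, let t vary. W_n(t)
commutes with every B_i(w) up to an explicit ratio of linear factors in t (`mul_wordSum_univ`). So
the entry in question, a polynomial in t of degree at most nm, is divisible by nm known linear
factors and is determined by its value at t = 0. There all colours in the additional rows leave from
column 0, this column is frozen below them, and the other m columns carry g_Δ of level m
(`extendedLimit_zero`). Evaluation at t = 1 gives `extendedLimit_one`; what remains is a computation
of constants. -/

namespace FermionicVertex

variable {n : ℕ}

/-! ### One-row partition functions with arbitrary vertex weights -/

section PathRow

variable {R : Type*} [CommRing R]

/-- The one-row partition function on `N` columns for the vertex weights `w` (arguments: bottom,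
right, top, left). -/
def pathRow (w : Finset (Fin n) → Option (Fin n) → Finset (Fin n) → Option (Fin n) → R) (N : ℕ)
    (i j : Option (Fin n)) : Matrix (Fin N → Finset (Fin n)) (Fin N → Finset (Fin n)) R :=
  Matrix.of fun A B => ∑ h : Fin (N + 1) → Option (Fin n),
    if h 0 = i ∧ h (Fin.last N) = j then
      ∏ k : Fin N, w (A k) (h k.succ) (B k) (h k.castSucc)
    else 0

variable (w : Finset (Fin n) → Option (Fin n) → Finset (Fin n) → Option (Fin n) → R)

theorem pathRow_zero (i j : Option (Fin n)) (A B : Fin 0 → Finset (Fin n)) :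
    pathRow w 0 i j A B = if i = j then 1 else 0 := by
  simp only [pathRow, Matrix.of_apply, Finset.univ_eq_empty, Finset.prod_empty]
  rw [← (Fin.consEquiv fun _ : Fin (0 + 1) => Option (Fin n)).sum_comp, Fintype.sum_prod_type]
  simp [Fin.consEquiv, ite_and]

theorem pathRow_cons (N : ℕ) (i j : Option (Fin n)) (a b : Finset (Fin n))
    (A B : Fin N → Finset (Fin n)) :
    pathRow w (N + 1) i j (Fin.cons (α := fun _ => Finset (Fin n)) a A)
      (Fin.cons (α := fun _ => Finset (Fin n)) b B) =
      ∑ h, w a h b i * pathRow w N h j A B := by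
  simp only [pathRow, Matrix.of_apply]
  rw [← (Fin.consEquiv fun _ : Fin (N + 1 + 1) => Option (Fin n)).sum_comp,
    Fintype.sum_prod_type, Finset.sum_eq_single i]
  · simp_rw [Finset.mul_sum]
    rw [Finset.sum_comm]
    refine Finset.sum_congr rfl fun g _ => ?_
    rw [Finset.sum_eq_single (g 0)]
    · simp only [Fin.consEquiv, Equiv.coe_fn_mk, Fin.cons_zero, true_and, Fin.prod_univ_succ,
        Fin.cons_succ, Fin.castSucc_zero, Fin.castSucc_succ, ← Fin.succ_last]
      split_ifs <;> simp
    · intro o _ ho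
      rw [if_neg fun h => ho h.1.symm, mul_zero]
    · intro h
      exact absurd (Finset.mem_univ _) h
  · intro o _ ho
    refine Finset.sum_eq_zero fun g _ => ?_
    rw [if_neg]
    rintro ⟨h, -⟩
    exact ho h
  · intro h
    exact absurd (Finset.mem_univ _) h

theorem map_pathRow {S : Type*} [CommRing S] (f : R →+* S) (N : ℕ) (i j : Option (Fin n)) :
    (pathRow w N i j).map f = pathRow (fun A b C d => f (w A b C d)) N i j := by
  ext A B
  simp only [pathRow, Matrix.map_apply, Matrix.of_apply, map_sum]
  refine Finset.sum_congr rfl fun h _ => ?_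
  split_ifs <;> simp

/-- The sum of all positions in a family of columns that is shifted to the right by `s`. -/
def position {N : ℕ} (s : ℕ) (A : Fin N → Finset (Fin n)) : ℕ := ∑ k : Fin N, (s + k) * (A k).card

theorem position_cons {N : ℕ} (s : ℕ) (a : Finset (Fin n)) (A : Fin N → Finset (Fin n)) :
    position s (Fin.cons (α := fun _ => Finset (Fin n)) a A) =
      s * a.card + position (s + 1) A := by
  simp only [position, Fin.sum_univ_succ, Fin.cons_zero, Fin.cons_succ, Fin.val_zero,
    Fin.val_succ, add_zero]
  congr 1
  exact Finset.sum_congr rfl fun k _ => by ring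

/-- The number of paths on a horizontal edge. -/
def edgeCount (b : Option (Fin n)) : ℕ := if b = none then 0 else 1

theorem Conserved.card {A C : Finset (Fin n)} {b d : Option (Fin n)} (h : Conserved A b C d) :
    A.card + edgeCount b = C.card + edgeCount d := by
  have hcard : ∀ S : Finset (Fin n), S.card = ∑ c, occ S c := by
    intro S
    simp [occ]
  have hedge : ∀ o : Option (Fin n), edgeCount o = ∑ c, unitVec o c := by
    rintro (_ | c) <;> simp [edgeCount, unitVec]
  rw [hcard, hcard, hedge, hedge, ← Finset.sum_add_distrib, ← Finset.sum_add_distrib]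
  exact Finset.sum_congr rfl fun c _ => h c

/-- Scaling each vertex by `r` for every path that leaves it on the horizontal edge to its right
changes a row only by a power of `r` that depends on the positions. -/
theorem pathRow_scale_shift (hw : ∀ A b C d, ¬ Conserved A b C d → w A b C d = 0) (r : R) (N s : ℕ)
    (i : Option (Fin n)) (A B : Fin N → Finset (Fin n)) :
    r ^ (position s B + s * edgeCount i) *
      pathRow (fun A b C d => r ^ edgeCount b * w A b C d) N i none A B =
    r ^ position s A * pathRow w N i none A B := by
  induction N generalizing i s with
  | zero =>
      rw [pathRow_zero, pathRow_zero]
      split_ifs with h <;> simp [h, position, edgeCount]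
  | succ N ih =>
      obtain ⟨a, A, rfl⟩ : ∃ a A', A = Fin.cons (α := fun _ => Finset (Fin n)) a A' :=
        ⟨A 0, Fin.tail A, (Fin.cons_self_tail A).symm⟩
      obtain ⟨b, B, rfl⟩ : ∃ b B', B = Fin.cons (α := fun _ => Finset (Fin n)) b B' :=
        ⟨B 0, Fin.tail B, (Fin.cons_self_tail B).symm⟩
      rw [pathRow_cons, pathRow_cons, Finset.mul_sum, Finset.mul_sum]
      refine Finset.sum_congr rfl fun h _ => ?_
      by_cases hc : Conserved a h b i
      · have e := congrArg (s * ·) hc.card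
        simp only [mul_add] at e
        rw [position_cons, position_cons]
        calc _ = w a h b i * (r ^ (s * b.card + s * edgeCount i) * (r ^ (position (s + 1) B +
              edgeCount h) * pathRow (fun A b C d => r ^ edgeCount b * w A b C d) N h none A B)) := by
              ring
          _ = w a h b i * (r ^ (s * a.card) * (r ^ (position (s + 1) B +
              (s + 1) * edgeCount h) *
              pathRow (fun A b C d => r ^ edgeCount b * w A b C d) N h none A B)) := by
              rw [← e]; ring
          _ = _ := by rw [ih]; ring
      · rw [hw _ _ _ _ hc]
        ring

/-- The positions of intermediate states telescope between consecutive rows. With `r = -s` this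
distributes a global power of `-s` over the vertices; with `r` a constant it expresses homogeneity
in the parameters. -/
theorem prod_pathRow_scale {ι : Type*} (w : ι → Finset (Fin n) → Option (Fin n) → Finset (Fin n) →
    Option (Fin n) → R) (hw : ∀ a A b C d, ¬ Conserved A b C d → w a A b C d = 0) (r : R)
    (N : ℕ) (l : List ι) (i : ι → Option (Fin n)) (A B : Fin N → Finset (Fin n)) :
    r ^ position 0 B *
      (l.map fun a => pathRow (fun A b C d => r ^ edgeCount b * w a A b C d) N (i a) none).prod A B =
    r ^ position 0 A * (l.map fun a => pathRow (w a) N (i a) none).prod A B := by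
  induction l generalizing A with
  | nil =>
      by_cases h : A = B
      · rw [h]; rfl
      · simp [h]
  | cons a l ih =>
      simp only [List.map_cons, List.prod_cons, Matrix.mul_apply]
      rw [Finset.mul_sum, Finset.mul_sum]
      refine Finset.sum_congr rfl fun C _ => ?_
      have h := pathRow_scale_shift (w a) (hw a) r N 0 (i a) A C
      rw [zero_mul, add_zero] at h
      rw [mul_left_comm, ih, mul_left_comm, ← mul_assoc, h]
      ring

end PathRow

/-! ### The weights at `s = 0` -/

section Weight

variable {R : Type*} [CommRing R]

/-- The nonzero values of the normalised weights at `s = 0`, with `p = q⁻¹`. -/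
def weightTable (p x : R) (A : Finset (Fin n)) : Option (Fin n) → Option (Fin n) → R
  | none, none => p ^ A.card
  | none, some i => (1 - p ^ occ A i) * p ^ above A i
  | some _, none => -(x * p ^ A.card)
  | some b, some d =>
      if b = d then (-1) ^ occ A b * x * p ^ above A b
      else if b < d then 0
      else x * (p ^ occ A d - 1) * p ^ above A d

/-- The value at `s = 0` of the vertex weight, multiplied by `-s` if a path enters from the right. -/
def weight (p x : R) (A : Finset (Fin n)) (b : Option (Fin n)) (C : Finset (Fin n))
    (d : Option (Fin n)) : R :=
  if Conserved A b C d then weightTable p x A b d else 0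

theorem weight_of_not_conserved (p x : R) (A : Finset (Fin n)) (b : Option (Fin n))
    (C : Finset (Fin n)) (d : Option (Fin n)) (h : ¬ Conserved A b C d) :
    weight p x A b C d = 0 := if_neg h

theorem map_weight {S : Type*} [CommRing S] (f : R →+* S) (p x : R) (A : Finset (Fin n))
    (b : Option (Fin n)) (C : Finset (Fin n)) (d : Option (Fin n)) :
    f (weight p x A b C d) = weight (f p) (f x) A b C d := by
  unfold weight
  split_ifs
  · cases b <;> cases d <;> simp only [weightTable]
    · simp
    · simp
    · simp
    · split_ifs <;> simp
  · simp

/-- Each weight is homogeneous in `x`, of degree the number of paths entering from the right. Both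
the scaling of all parameters and the degree bounds in `t` rest on this. -/
theorem weight_mul (p r x : R) (A : Finset (Fin n)) (b : Option (Fin n)) (C : Finset (Fin n))
    (d : Option (Fin n)) : weight p (r * x) A b C d = r ^ edgeCount b * weight p x A b C d := by
  unfold weight
  split_ifs
  · cases b <;> cases d <;> simp only [weightTable, edgeCount, if_true, reduceCtorEq, if_false]
    · ring
    · ring
    · ring
    · split_ifs <;> ring
  · simp

/-- The row operator at `s = 0`. -/
def zeroRow (p : R) (N : ℕ) (x : R) (i j : Option (Fin n)) :
    Matrix (Fin N → Finset (Fin n)) (Fin N → Finset (Fin n)) R :=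
  pathRow (weight p x) N i j

theorem map_zeroRow {S : Type*} [CommRing S] (f : R →+* S) (p : R) (N : ℕ) (x : R)
    (i j : Option (Fin n)) : (zeroRow p N x i j).map f = zeroRow (f p) N (f x) i j := by
  rw [zeroRow, map_pathRow, zeroRow]
  congr 1
  funext A b C d
  exact map_weight f p x A b C d

theorem prod_zeroRow_mul {ι : Type*} (p r : R) (N : ℕ) (l : List ι) (x : ι → R)
    (i : ι → Option (Fin n)) (A B : Fin N → Finset (Fin n)) :
    r ^ position 0 B * (l.map fun a => zeroRow p N (r * x a) (i a) none).prod A B =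
    r ^ position 0 A * (l.map fun a => zeroRow p N (x a) (i a) none).prod A B := by
  have h := prod_pathRow_scale (fun a => weight p (x a)) (fun a => weight_of_not_conserved p (x a))
    r N l i A B
  simp only [← weight_mul] at h
  exact h

end Weight

/-! ### Regularity at `s = 0` -/

section Regular

variable {K : Type*} [Field K]

/-- The graph of the evaluation at `0` on the rational functions that are regular there. -/
def regularGraph (K : Type*) [Field K] : Subring (RatFunc K × K) where
  carrier := {f | f.1.denom.eval 0 ≠ 0 ∧ f.1.eval (RingHom.id K) 0 = f.2}
  mul_mem' := by
    rintro ⟨f, a⟩ ⟨g, b⟩ ⟨hf, ha⟩ ⟨hg, hb⟩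
    obtain rfl : f.eval (RingHom.id K) 0 = a := ha
    obtain rfl : g.eval (RingHom.id K) 0 = b := hb
    obtain ⟨c, hc⟩ := RatFunc.denom_mul_dvd f g
    refine ⟨fun h => ?_, RatFunc.eval_mul _ _ (by rwa [Polynomial.eval₂_id]) (by rwa [Polynomial.eval₂_id])⟩
    have := congrArg (Polynomial.eval 0) hc
    rw [Polynomial.eval_mul, Polynomial.eval_mul] at this
    rw [show Polynomial.eval 0 (f * g).denom = 0 from h, zero_mul] at this
    exact mul_ne_zero hf hg this
  add_mem' := by
    rintro ⟨f, a⟩ ⟨g, b⟩ ⟨hf, ha⟩ ⟨hg, hb⟩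
    obtain rfl : f.eval (RingHom.id K) 0 = a := ha
    obtain rfl : g.eval (RingHom.id K) 0 = b := hb
    obtain ⟨c, hc⟩ := RatFunc.denom_add_dvd f g
    refine ⟨fun h => ?_, RatFunc.eval_add _ _ (by rwa [Polynomial.eval₂_id]) (by rwa [Polynomial.eval₂_id])⟩
    have := congrArg (Polynomial.eval 0) hc
    rw [Polynomial.eval_mul, Polynomial.eval_mul] at this
    rw [show Polynomial.eval 0 (f + g).denom = 0 from h, zero_mul] at this
    exact mul_ne_zero hf hg this
  one_mem' := by simp
  zero_mem' := by simp
  neg_mem' := by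
    rintro ⟨f, a⟩ ⟨hf, ha⟩
    obtain rfl : f.eval (RingHom.id K) 0 = a := ha
    have h1 : (-1 : RatFunc K) = RatFunc.C (-1) := by simp
    have hd : ((-1 : RatFunc K)).denom.eval 0 ≠ 0 := by
      rw [h1, RatFunc.denom_C]; simp
    obtain ⟨c, hc⟩ := RatFunc.denom_mul_dvd (-1) f
    refine ⟨fun h => ?_, ?_⟩
    · have := congrArg (Polynomial.eval 0) hc
      rw [Polynomial.eval_mul, Polynomial.eval_mul] at this
      rw [show Polynomial.eval 0 (-1 * f).denom = 0 by rw [neg_one_mul]; exact h, zero_mul] at this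
      exact mul_ne_zero hd hf this
    · change (-f).eval (RingHom.id K) 0 = - f.eval (RingHom.id K) 0
      rw [← neg_one_mul, RatFunc.eval_mul _ _ (by rwa [Polynomial.eval₂_id]) (by rwa [Polynomial.eval₂_id]), h1, RatFunc.eval_C]
      simp

/-- The reduced denominator divides `b`, so it does not vanish at 0 either; cross-multiplication
then yields the value. -/
theorem div_mem_regularGraph (a b : Polynomial K) (hb : b.eval 0 ≠ 0) :
    (algebraMap _ (RatFunc K) a / algebraMap _ (RatFunc K) b, a.eval 0 / b.eval 0) ∈
      regularGraph K := by
  have hb0 : b ≠ 0 := by rintro rfl; simp at hb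
  obtain ⟨c, hc⟩ := RatFunc.denom_div_dvd a b
  have hd : (algebraMap _ (RatFunc K) a / algebraMap _ (RatFunc K) b).denom.eval 0 ≠ 0 := by
    intro h
    apply hb
    rw [hc, Polynomial.eval_mul, h, zero_mul]
  refine ⟨hd, ?_⟩
  have e := RatFunc.num_div_denom (algebraMap _ (RatFunc K) a / algebraMap _ (RatFunc K) b)
  have hd0 := RatFunc.denom_ne_zero (algebraMap _ (RatFunc K) a / algebraMap _ (RatFunc K) b)
  have hbm : algebraMap (Polynomial K) (RatFunc K) b ≠ 0 := by simpa using hb0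
  have hdm := (map_ne_zero_iff _ (RatFunc.algebraMap_injective K)).2 hd0
  rw [div_eq_div_iff hdm hbm, ← map_mul, ← map_mul] at e
  have e' := congrArg (Polynomial.eval 0) (RatFunc.algebraMap_injective K e)
  rw [Polynomial.eval_mul, Polynomial.eval_mul] at e'
  simp only [RatFunc.eval, ← Polynomial.eval₂_id] at *
  rw [div_eq_div_iff (by rwa [Polynomial.eval₂_id]) (by simpa using hb)]
  simpa using e'

theorem sub_mul_X_ne_zero (a b : K) (ha : a ≠ 0) : RatFunc.C a - RatFunc.X * RatFunc.C b ≠ 0 := by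
  intro h
  have h1 : algebraMap (Polynomial K) (RatFunc K) (Polynomial.C a - Polynomial.X * Polynomial.C b) =
      0 := by
    rw [← h, map_sub, map_mul, RatFunc.algebraMap_X, RatFunc.algebraMap_C, RatFunc.algebraMap_C]
  rw [map_eq_zero_iff _ (RatFunc.algebraMap_injective K)] at h1
  have := congrArg (Polynomial.eval 0) h1
  simp at this
  exact ha this

/-- The numerators of the normalised weights, for the denominator `1 - s z`. -/
def numeratorTable {R : Type*} [CommRing R] (p s z : R) (A : Finset (Fin n)) :
    Option (Fin n) → Option (Fin n) → R
  | none, none => p ^ A.card - s * z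
  | none, some i => (1 - p ^ occ A i) * p ^ above A i
  | some _, none => z * (s ^ 2 - p ^ A.card)
  | some b, some d =>
      if b = d then (-1) ^ occ A b * (z - s * p ^ occ A b) * p ^ above A b
      else if b < d then s * (p ^ occ A d - 1) * p ^ above A d
      else z * (p ^ occ A d - 1) * p ^ above A d

/-- Inverting the parameters turns the prefactor into -sz / (1 - sz). The weights are then regular
at s = 0 if no path enters from the right and have at most a simple pole otherwise, which the factor
`-s` removes. -/
theorem LTable_inv {F : Type*} [Field F] (p s z : F) (hs : s ≠ 0) (hz : z ≠ 0)
    (h : 1 - s * z ≠ 0) (A : Finset (Fin n)) (b d : Option (Fin n)) :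
    (-s) ^ edgeCount b * LTable p s⁻¹ z⁻¹ A b d * (1 - s * z) = numeratorTable p s z A b d := by
  have h2 : s * z - 1 ≠ 0 := sub_ne_zero.2 (sub_ne_zero.1 h).symm
  have e : (1 - s⁻¹ * z⁻¹)⁻¹ * (1 - s * z) = -(s * z) := by
    have h3 : 1 - s⁻¹ * z⁻¹ = (s * z - 1) / (s * z) := by field_simp
    rw [h3]
    field_simp
    ring
  cases b <;> cases d <;> simp only [LTable, numeratorTable, edgeCount, if_true, reduceCtorEq,
    if_false, pow_zero, pow_one, one_mul, div_eq_mul_inv]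
  · rw [mul_assoc, e]; field_simp; ring
  · rw [mul_assoc, e]; field_simp; ring
  · rw [mul_assoc, mul_assoc, e]; field_simp
  · split_ifs
    · rw [mul_assoc, mul_assoc, e]; field_simp
    · rw [mul_assoc, mul_assoc, e]; field_simp
    · rw [mul_assoc, mul_assoc, e]; field_simp

theorem map_numeratorTable {R S : Type*} [CommRing R] [CommRing S] (f : R →+* S) (p s z : R)
    (A : Finset (Fin n)) (b d : Option (Fin n)) :
    f (numeratorTable p s z A b d) = numeratorTable (f p) (f s) (f z) A b d := by
  cases b <;> cases d <;> simp only [numeratorTable]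
  · simp
  · simp
  · simp
  · split_ifs <;> simp

theorem numeratorTable_zero {R : Type*} [CommRing R] (p z : R) (A : Finset (Fin n))
    (b d : Option (Fin n)) : numeratorTable p 0 z A b d = weightTable p z A b d := by
  cases b <;> cases d <;> simp only [numeratorTable, weightTable]
  · ring
  · ring
  · split_ifs <;> ring

theorem MWeight_mem_regularGraph (q x : K) (hx : x ≠ 0) (A : Finset (Fin n))
    (b : Option (Fin n)) (C : Finset (Fin n)) (d : Option (Fin n)) :
    ((-RatFunc.X) ^ edgeCount b * MWeight (RatFunc.C q) RatFunc.X (RatFunc.C x) A b C d,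
      weight q⁻¹ x A b C d) ∈ regularGraph K := by
  unfold MWeight LWeight weight
  by_cases hc : Conserved A b C d
  · rw [if_pos hc, if_pos hc, ← map_inv₀]
    have h1 : (1 : RatFunc K) - RatFunc.X * RatFunc.C x ≠ 0 := by
      simpa using sub_mul_X_ne_zero 1 x one_ne_zero
    have e := LTable_inv (RatFunc.C q⁻¹) RatFunc.X (RatFunc.C x) RatFunc.X_ne_zero
      (by simpa using hx) h1 A b d
    have := div_mem_regularGraph (numeratorTable (Polynomial.C q⁻¹) Polynomial.X (Polynomial.C x)
      A b d) (1 - Polynomial.X * Polynomial.C x) (by simp)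
    rw [map_numeratorTable, map_sub, map_one, map_mul, RatFunc.algebraMap_X, RatFunc.algebraMap_C,
      RatFunc.algebraMap_C, ← e, mul_div_cancel_right₀ _ h1, ← Polynomial.coe_evalRingHom,
      map_numeratorTable] at this
    simpa [numeratorTable_zero] using this
  · rw [if_neg hc, if_neg hc, mul_zero]
    exact zero_mem _

theorem sum_mem_regularGraph {ι : Type*} (s : Finset ι) (f : ι → RatFunc K) (g : ι → K)
    (h : ∀ i ∈ s, (f i, g i) ∈ regularGraph K) :
    (∑ i ∈ s, f i, ∑ i ∈ s, g i) ∈ regularGraph K := by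
  have := (regularGraph K).sum_mem (t := s) (f := fun i => (f i, g i)) h
  rwa [show ∑ i ∈ s, (f i, g i) = (∑ i ∈ s, f i, ∑ i ∈ s, g i) from
    Prod.ext Prod.fst_sum Prod.snd_sum] at this

theorem pathRow_mem_regularGraph {w : Finset (Fin n) → Option (Fin n) → Finset (Fin n) →
    Option (Fin n) → RatFunc K} {v : Finset (Fin n) → Option (Fin n) → Finset (Fin n) →
    Option (Fin n) → K} (h : ∀ A b C d, (w A b C d, v A b C d) ∈ regularGraph K) (N : ℕ)
    (i j : Option (Fin n)) (A B : Fin N → Finset (Fin n)) :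
    (pathRow w N i j A B, pathRow v N i j A B) ∈ regularGraph K := by
  induction N generalizing i with
  | zero =>
      rw [pathRow_zero, pathRow_zero]
      split_ifs
      · exact one_mem _
      · exact zero_mem _
  | succ N ih =>
      obtain ⟨a, A, rfl⟩ : ∃ a A', A = Fin.cons (α := fun _ => Finset (Fin n)) a A' :=
        ⟨A 0, Fin.tail A, (Fin.cons_self_tail A).symm⟩
      obtain ⟨b, B, rfl⟩ : ∃ b B', B = Fin.cons (α := fun _ => Finset (Fin n)) b B' :=
        ⟨B 0, Fin.tail B, (Fin.cons_self_tail B).symm⟩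
      rw [pathRow_cons, pathRow_cons]
      exact sum_mem_regularGraph _ _ _ fun g _ => mul_mem (h a g b i) (ih g A B)

theorem prod_mem_regularGraph {ι α : Type*} [Fintype α] [DecidableEq α]
    (M : ι → Matrix α α (RatFunc K)) (M' : ι → Matrix α α K)
    (h : ∀ i A B, (M i A B, M' i A B) ∈ regularGraph K) (l : List ι) (A B : α) :
    ((l.map M).prod A B, (l.map M').prod A B) ∈ regularGraph K := by
  induction l generalizing A with
  | nil =>
      by_cases hAB : A = B
      · subst hAB
        simp only [List.map_nil, List.prod_nil, Matrix.one_apply_eq]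
        exact one_mem (regularGraph K)
      · simp only [List.map_nil, List.prod_nil, Matrix.one_apply_ne hAB]
        exact zero_mem (regularGraph K)
  | cons i l ih =>
      simp only [List.map_cons, List.prod_cons, Matrix.mul_apply]
      exact sum_mem_regularGraph _ _ _ fun C _ => mul_mem (h i A C) (ih C)

theorem width_delta (m : ℕ) (hn : 1 ≤ n) : (delta n m).width = m := by
  have h : ∀ m : ℕ, ((Finset.range m).sup fun k => k + 1) = m := by
    intro m
    induction m with
    | zero => rfl
    | succ m ih => rw [Finset.range_add_one, Finset.sup_insert, ih]; simp
  have : Nonempty (Fin n) := ⟨⟨0, hn⟩⟩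
  simp only [ColouredComposition.width, delta, h]
  exact Finset.sup_const Finset.univ_nonempty m

theorem column_delta (m : ℕ) (k : Fin m) : (delta n m).column k = Finset.univ := by
  simp [ColouredComposition.column, delta]

theorem size_delta (m : ℕ) :
    (delta n m).size = position 0 (fun k : Fin m => (delta n m).column k) := by
  simp only [column_delta, position]
  simp only [ColouredComposition.size, delta]
  rw [← Fin.sum_univ_eq_sum_range (fun k => k) m, Finset.sum_const, Finset.smul_sum]
  exact Finset.sum_congr rfl fun k _ => by simp [mul_comm]

/-- The value of `g_Δ` at `s = 0`, as a partition function on `m` columns. -/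
def gLimit {R : Type*} [CommRing R] (n m : ℕ) (p : R) (l : List (Fin n × R)) : R :=
  (l.map fun a => zeroRow p m a.2 (some a.1) none).prod (fun _ => Finset.univ) (fun _ => ∅)

/-- The size of Δ is the total position of the bottom state. The prefactor (-s)^|Δ| therefore
supplies exactly one factor `-s` to each vertex entered by a path from the right, and every vertex
becomes regular on its own. -/
theorem gRat_delta_mem_regularGraph (q : K) (m : ℕ) (hn : 1 ≤ n) {k : ℕ} (σ : Fin k → Fin n)
    (x : Fin k → K) (hx : ∀ a, x a ≠ 0) :
    (gRat q (delta n m) σ x, gLimit n m q⁻¹ (List.ofFn fun a => (σ a, x a))) ∈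
      regularGraph K := by
  have hpos := prod_pathRow_scale (fun a => MWeight (RatFunc.C q) RatFunc.X (RatFunc.C (x a)))
    (fun a A b C d h => if_neg h) (-RatFunc.X) m (List.finRange k) (fun a => some (σ a))
    (fun k => (delta n m).column k) (fun _ => ∅)
  rw [← size_delta] at hpos
  have h0 : position 0 (fun _ : Fin m => (∅ : Finset (Fin n))) = 0 := by simp [position]
  rw [h0, pow_zero, one_mul] at hpos
  have e : gRat q (delta n m) σ x = (-RatFunc.X) ^ (delta n m).size *
      ((List.finRange k).map fun a => pathRow (MWeight (RatFunc.C q) RatFunc.X (RatFunc.C (x a))) m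
        (some (σ a)) none).prod (fun k => (delta n m).column k) (fun _ => ∅) := by
    unfold gRat gFun gPartition
    rw [width_delta m hn, List.ofFn_eq_map]
    rfl
  rw [e, ← hpos]
  have := prod_mem_regularGraph
    (fun a => pathRow (fun A b C d => (-RatFunc.X) ^ edgeCount b *
      MWeight (RatFunc.C q) RatFunc.X (RatFunc.C (x a)) A b C d) m (some (σ a)) none)
    (fun a => zeroRow q⁻¹ m (x a) (some (σ a)) none)
    (fun a => pathRow_mem_regularGraph (fun A b C d => MWeight_mem_regularGraph q (x a) (hx a) A b C d)
      m _ _) (List.finRange k) (fun k => (delta n m).column k) (fun _ => ∅)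
  simpa [gLimit, List.ofFn_eq_map, Function.comp_def, column_delta] using this

end Regular

/-! ### The exchange relation for one vertex

Labels are encoded as natural numbers, `0` being the empty label. -/

section Scalar

variable {R : Type*} [CommRing R]

/-- The weight of a vertex with left label `d` and right label `b`, up to a power of `p`; `u` and `v`
tell whether `d` and `b` are present in the bottom label. -/
def coef (p x : R) (d b : ℕ) (u v : Bool) : R :=
  if d = b then (if d = 0 then 1 else bif u then -x else x)
  else if b = 0 then (bif u then 1 - p else 0)
  else bif v then 0
  else if d = 0 then -x
  else if d < b then (bif u then x * (p - 1) else 0)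
  else 0

/-- The presence of colours after a vertex with left label `d` and right label `b`. -/
def stepBool (o : ℕ → Bool) (d b z : ℕ) : Bool :=
  if d = b then o z else if z = d then false else if z = b then true else o z

/-- The weight of two vertices on top of each other, up to a power of `p`. -/
def coefTwo (p x y : R) (o : ℕ → Bool) (d₁ b₁ d₂ b₂ : ℕ) : R :=
  coef p x d₁ b₁ (o d₁) (o b₁) * coef p y d₂ b₂ (stepBool o d₁ b₁ d₂) (stepBool o d₁ b₁ b₂) *
    ((if d₂ < d₁ then 1 else p) * (if d₂ < b₁ then p else 1))

/-- The coefficient of the exchange relation that keeps the labels. -/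
def exchKeep (p x y : R) (d₁ d₂ : ℕ) : R :=
  if d₁ = d₂ then (if d₁ = 0 then x - p * y else y - p * x)
  else if d₁ < d₂ then (1 - p) * y else (1 - p) * x

/-- The coefficient of the exchange relation that swaps the labels. -/
def exchSwap (p x y : R) (d₁ d₂ : ℕ) : R :=
  if d₁ = d₂ then 0 else if d₁ < d₂ then p * (x - y) else x - y

/-- All forms of the comparison are recorded at once, so that `simp` can decide every condition in
the case analysis below. -/
theorem lt_trichotomy_extended (a b : ℕ) : (a < b ∧ a ≠ b ∧ b ≠ a ∧ ¬ b < a) ∨ a = b ∨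
    (b < a ∧ a ≠ b ∧ b ≠ a ∧ ¬ a < b) := by omega

theorem eq_zero_or_ne (a : ℕ) : a = 0 ∨ (a ≠ 0 ∧ 0 ≠ a ∧ 0 < a) := by omega

set_option maxHeartbeats 4000000 in
-- The Yang–Baxter relation of one column at s = 0, with the common power of `p` stripped off. It
-- depends only on the relative order of the four labels, on which of them are empty, and on the
-- occupation bits, so it is a finite check.
theorem coefTwo_exchange (p x y : R) (o : ℕ → Bool) (d₁ d₂ b₁ b₂ : ℕ) :
    exchKeep p x y d₁ d₂ * coefTwo p x y o d₁ b₁ d₂ b₂ +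
      exchSwap p x y d₁ d₂ * coefTwo p x y o d₂ b₁ d₁ b₂ =
    exchKeep p x y b₁ b₂ * coefTwo p y x o d₁ b₁ d₂ b₂ +
      exchSwap p x y b₂ b₁ * coefTwo p y x o d₁ b₂ d₂ b₁ := by
  rcases lt_trichotomy_extended d₁ d₂ with ⟨h1, h2, h3, h4⟩ | h | ⟨h1, h2, h3, h4⟩ <;>
  rcases lt_trichotomy_extended b₁ b₂ with ⟨k1, k2, k3, k4⟩ | k | ⟨k1, k2, k3, k4⟩ <;>
  rcases lt_trichotomy_extended d₁ b₁ with ⟨l1, l2, l3, l4⟩ | l | ⟨l1, l2, l3, l4⟩ <;>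
  rcases lt_trichotomy_extended d₁ b₂ with ⟨m1, m2, m3, m4⟩ | m | ⟨m1, m2, m3, m4⟩ <;>
  (try (exfalso; omega)) <;>
  rcases lt_trichotomy_extended d₂ b₁ with ⟨i1, i2, i3, i4⟩ | i | ⟨i1, i2, i3, i4⟩ <;>
  (try (exfalso; omega)) <;>
  rcases lt_trichotomy_extended d₂ b₂ with ⟨j1, j2, j3, j4⟩ | j | ⟨j1, j2, j3, j4⟩ <;>
  (try (exfalso; omega)) <;>
  rcases eq_zero_or_ne d₁ with z0 | ⟨z0, y0, w0⟩ <;>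
  (try (exfalso; omega)) <;>
  rcases eq_zero_or_ne d₂ with z1 | ⟨z1, y1, w1⟩ <;>
  (try (exfalso; omega)) <;>
  rcases eq_zero_or_ne b₁ with z2 | ⟨z2, y2, w2⟩ <;>
  (try (exfalso; omega)) <;>
  rcases eq_zero_or_ne b₂ with z3 | ⟨z3, y3, w3⟩ <;>
  (try (exfalso; omega)) <;>
  subst_vars <;>
  simp only [*, exchKeep, exchSwap, coefTwo, coef, stepBool, if_true, if_false, lt_irrefl,
    Bool.cond_eq_ite, Bool.false_eq_true, zero_mul, mul_zero, add_zero] <;>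
  first
  | rfl
  | ring1
  | (split_ifs <;> ring1)

end Scalar

/-! ### The exchange relation for vertices and for whole rows -/

section Exchange

variable {R : Type*} [CommRing R]

/-- The encoding of labels by natural numbers. -/
def labelKey : Option (Fin n) → ℕ
  | none => 0
  | some c => c + 1

theorem labelKey_injective : Function.Injective (labelKey (n := n)) := by
  rintro (_ | a) (_ | b) h
  · rfl
  · simp [labelKey] at h
  · simp [labelKey] at h
  · simp only [labelKey, Nat.add_right_cancel_iff] at h
    rw [Fin.ext h]

/-- The presence of colours in a set, in terms of the encoding. -/
def memKey (A : Finset (Fin n)) (k : ℕ) : Bool := decide (∃ c ∈ A, labelKey (some c) = k)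

theorem memKey_some (A : Finset (Fin n)) (c : Fin n) :
    memKey A (labelKey (some c)) = decide (c ∈ A) := by
  simp only [memKey, decide_eq_decide]
  constructor
  · rintro ⟨d, hd, h⟩
    obtain rfl : d = c := by simpa using labelKey_injective h
    exact hd
  · exact fun h => ⟨c, h, rfl⟩

/-- The number of colours above a label. -/
def aboveLabel (A : Finset (Fin n)) : Option (Fin n) → ℕ
  | none => A.card
  | some c => above A c

theorem aboveLabel_eq_sum (A : Finset (Fin n)) (d : Option (Fin n)) :
    aboveLabel A d = ∑ c, if labelKey d < labelKey (some c) then occ A c else 0 := by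
  cases d with
  | none => simp [aboveLabel, labelKey, occ]
  | some d =>
    simp only [aboveLabel, above, labelKey, occ, add_lt_add_iff_right, Fin.val_fin_lt,
      Finset.card_filter]
    rw [← Finset.univ_inter A, ← Finset.sum_ite_mem, Finset.univ_inter]
    refine Finset.sum_congr rfl fun c _ => ?_
    split_ifs <;> rfl

/-- When `b` is a colour different from `d`, conservation excludes `b ∈ A`; the value 0 that `coef`
takes there is thus consistent. -/
theorem weight_eq_coef (p x : R) (A : Finset (Fin n)) (b : Option (Fin n)) (C : Finset (Fin n))
    (d : Option (Fin n)) : weight p x A b C d = if Conserved A b C d then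
      coef p x (labelKey d) (labelKey b) (memKey A (labelKey d)) (memKey A (labelKey b)) *
        p ^ aboveLabel A d else 0 := by
  unfold weight
  split_ifs with h
  · cases b with
    | none =>
      cases d with
      | none => simp [weightTable, coef, aboveLabel, labelKey]
      | some d =>
        rw [memKey_some]
        simp only [weightTable, coef, aboveLabel]
        by_cases hd : d ∈ A <;> simp [hd, labelKey, occ]
    | some b =>
      cases d with
      | none =>
        have hb := h b
        have : b ∉ A := by
          intro hA
          simp only [occ, unitVec, hA, if_true, reduceCtorEq, if_false] at hb
          split_ifs at hb <;> omega
        rw [memKey_some]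
        simp [weightTable, coef, aboveLabel, labelKey, this]
      | some d =>
        rw [memKey_some, memKey_some]
        by_cases hbd : b = d
        · subst hbd
          by_cases hd : b ∈ A <;> simp [weightTable, coef, aboveLabel, labelKey, occ, hd]
        · have hb := h b
          have : b ∉ A := by
            intro hA
            have : d ≠ b := Ne.symm hbd
            simp only [occ, unitVec, hA, if_true, Option.some.injEq, this, if_false] at hb
            split_ifs at hb <;> omega
          have hlt : (d : ℕ) < b ↔ ¬ b < d := by
            rw [Fin.val_fin_lt, not_lt, le_iff_lt_or_eq]
            simp [Ne.symm hbd]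
          have hne : (d : ℕ) ≠ b := fun h => hbd (Fin.ext h.symm)
          by_cases hlt' : b < d <;> by_cases hd : d ∈ A <;>
          simp [weightTable, coef, aboveLabel, labelKey, occ, hd, this, hbd, hlt, hlt', hne]
  · rfl

/-- Conservation of colours at two vertices on top of each other. -/
def ConservedTwo (A : Finset (Fin n)) (b₁ b₂ : Option (Fin n)) (C : Finset (Fin n))
    (d₁ d₂ : Option (Fin n)) : Prop :=
  ∀ c, occ A c + unitVec b₁ c + unitVec b₂ c = occ C c + unitVec d₁ c + unitVec d₂ c

theorem conservedTwo_comm_right (A : Finset (Fin n)) (b₁ b₂ : Option (Fin n)) (C : Finset (Fin n))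
    (d₁ d₂ : Option (Fin n)) : ConservedTwo A b₂ b₁ C d₁ d₂ ↔ ConservedTwo A b₁ b₂ C d₁ d₂ :=
  forall_congr' fun c => by omega

theorem conservedTwo_comm_left (A : Finset (Fin n)) (b₁ b₂ : Option (Fin n)) (C : Finset (Fin n))
    (d₁ d₂ : Option (Fin n)) : ConservedTwo A b₁ b₂ C d₂ d₁ ↔ ConservedTwo A b₁ b₂ C d₁ d₂ :=
  forall_congr' fun c => by omega

/-- The top label of a vertex. -/
def stepSet (A : Finset (Fin n)) (b d : Option (Fin n)) : Finset (Fin n) :=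
  Finset.univ.filter fun c => stepBool (memKey A) (labelKey d) (labelKey b) (labelKey (some c))

theorem memKey_stepSet (A : Finset (Fin n)) (b d e : Option (Fin n)) (he : e ≠ none) :
    memKey (stepSet A b d) (labelKey e) =
      stepBool (memKey A) (labelKey d) (labelKey b) (labelKey e) := by
  cases e with
  | none => exact absurd rfl he
  | some c =>
    rw [memKey_some]
    simp [stepSet]

theorem Conserved.top_unique {A C C' : Finset (Fin n)} {b d : Option (Fin n)}
    (h : Conserved A b C d) (h' : Conserved A b C' d) : C = C' := by
  ext c
  have := (h c).symm.trans (h' c)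
  simp only [occ] at this
  split_ifs at this <;> simp_all

/-- For `b ≠ d` a legal top label could fail to exist only if the colour `d` is missing below or the
colour `b` is already there; `coef` vanishes in both cases. -/
theorem conserved_stepSet (p x : R) (A : Finset (Fin n)) (b d : Option (Fin n))
    (h : coef p x (labelKey d) (labelKey b) (memKey A (labelKey d)) (memKey A (labelKey b)) ≠ 0) :
    Conserved A b (stepSet A b d) d := by
  intro c
  have hocc : occ (stepSet A b d) c = if stepBool (memKey A) (labelKey d) (labelKey b)
      (labelKey (some c)) then 1 else 0 := by simp [occ, stepSet]
  have hk : ∀ o : Option (Fin n), unitVec o c = if labelKey (some c) = labelKey o then 1 else 0 := by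
    intro o
    simp only [unitVec, labelKey_injective.eq_iff, eq_comm]
  have hA : occ A c = if memKey A (labelKey (some c)) then 1 else 0 := by
    rw [memKey_some]; simp [occ]
  have hc0 : labelKey (some c) ≠ 0 := by simp [labelKey]
  rw [hocc, hk, hk, hA]
  generalize labelKey (some c) = z at *
  generalize labelKey d = e at *
  generalize labelKey b = f at *
  generalize memKey A = o at *
  unfold stepBool
  unfold coef at h
  by_cases h1 : e = f
  · simp [h1]
  · by_cases h2 : z = e
    · subst h2
      rw [if_neg h1] at h
      cases hz : o z
      · simp [hz, hc0] at h
      · simp [h1]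
    · by_cases h3 : z = f
      · subst h3
        cases hz : o z
        · simp [h1, h2]
        · simp [hz, hc0, h1] at h
      · simp [h1, h2, h3]

theorem Conserved.aboveLabel {A C : Finset (Fin n)} {b d : Option (Fin n)} (h : Conserved A b C d)
    (e : Option (Fin n)) :
    FermionicVertex.aboveLabel A e + (if labelKey e < labelKey b then 1 else 0) =
      FermionicVertex.aboveLabel C e + (if labelKey e < labelKey d then 1 else 0) := by
  have key : ∀ o : Option (Fin n), (if labelKey e < labelKey o then 1 else 0) =
      ∑ c, if labelKey e < labelKey (some c) then unitVec o c else 0 := by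
    rintro (_ | c)
    · simp [labelKey, unitVec]
    · rw [Finset.sum_eq_single c]
      · simp [unitVec]
      · intro c' _ hc'
        simp [unitVec, Ne.symm hc']
      · simp
  rw [key, key, aboveLabel_eq_sum, aboveLabel_eq_sum, ← Finset.sum_add_distrib,
    ← Finset.sum_add_distrib]
  refine Finset.sum_congr rfl fun c _ => ?_
  split_ifs
  · exact h c
  · rfl

/-- The vertex with left label `d` and right label `b` as an operator from bottom to top. -/
def vertex (p x : R) (d b : Option (Fin n)) : Matrix (Finset (Fin n)) (Finset (Fin n)) R :=
  Matrix.of fun A C => weight p x A b C d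

open Classical in
-- The intermediate label is forced, so the sum has at most one term. The extra factor `p` on the
-- left keeps exponents nonnegative: the number of colours above `d₂` may drop by one at the first
-- vertex.
theorem vertex_mul_vertex (p x y : R) (d₁ b₁ d₂ b₂ : Option (Fin n)) (A C : Finset (Fin n)) :
    p * (vertex p x d₁ b₁ * vertex p y d₂ b₂) A C = if ConservedTwo A b₁ b₂ C d₁ d₂ then
      coefTwo p x y (memKey A) (labelKey d₁) (labelKey b₁) (labelKey d₂) (labelKey b₂) *
        (p ^ aboveLabel A d₁ * p ^ aboveLabel A d₂) else 0 := by
  rw [Matrix.mul_apply]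
  simp only [vertex, Matrix.of_apply]
  by_cases hz : coef p x (labelKey d₁) (labelKey b₁) (memKey A (labelKey d₁))
      (memKey A (labelKey b₁)) = 0
  · have : ∀ A', weight p x A b₁ A' d₁ = 0 := by
      intro A'
      rw [weight_eq_coef, hz]; simp
    simp [this, coefTwo, hz]
  · have h1 := conserved_stepSet p x A b₁ d₁ hz
    rw [Finset.sum_eq_single (stepSet A b₁ d₁)]
    · rw [weight_eq_coef, if_pos h1, weight_eq_coef]
      have hiff : Conserved (stepSet A b₁ d₁) b₂ C d₂ ↔ ConservedTwo A b₁ b₂ C d₁ d₂ := by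
        refine forall_congr' fun c => ?_
        have := h1 c
        omega
      by_cases h2 : ConservedTwo A b₁ b₂ C d₁ d₂
      · rw [if_pos h2, if_pos (hiff.2 h2)]
        have hpow : p * p ^ aboveLabel (stepSet A b₁ d₁) d₂ = p ^ aboveLabel A d₂ *
            ((if labelKey d₂ < labelKey d₁ then 1 else p) *
              (if labelKey d₂ < labelKey b₁ then p else 1)) := by
          have := h1.aboveLabel d₂
          split_ifs at this ⊢
          · rw [Nat.add_right_cancel_iff.1 this]; ring
          · rw [← add_zero (aboveLabel A d₂), this]; ring
          · rw [← add_zero (aboveLabel (stepSet A b₁ d₁) d₂), ← this]; ring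
          · rw [Nat.add_right_cancel_iff.1 this]; ring
        -- For the empty label the two occupation bits may disagree, but `coef` ignores the bit of
        -- an empty label.
        have hcoef : coef p y (labelKey d₂) (labelKey b₂) (memKey (stepSet A b₁ d₁) (labelKey d₂))
            (memKey (stepSet A b₁ d₁) (labelKey b₂)) = coef p y (labelKey d₂) (labelKey b₂)
              (stepBool (memKey A) (labelKey d₁) (labelKey b₁) (labelKey d₂))
              (stepBool (memKey A) (labelKey d₁) (labelKey b₁) (labelKey b₂)) := by
          rcases d₂ with _ | d₂ <;> rcases b₂ with _ | b₂
          · simp [coef, labelKey]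
          · rw [memKey_stepSet _ _ _ (some b₂) (by simp)]
            simp [coef, labelKey]
          · rw [memKey_stepSet _ _ _ (some d₂) (by simp)]
            simp [coef, labelKey]
          · rw [memKey_stepSet _ _ _ (some b₂) (by simp), memKey_stepSet _ _ _ (some d₂) (by simp)]
        rw [hcoef]
        unfold coefTwo
        linear_combination (coef p x (labelKey d₁) (labelKey b₁) (memKey A (labelKey d₁))
          (memKey A (labelKey b₁)) * p ^ aboveLabel A d₁ * coef p y (labelKey d₂) (labelKey b₂)
              (stepBool (memKey A) (labelKey d₁) (labelKey b₁) (labelKey d₂))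
              (stepBool (memKey A) (labelKey d₁) (labelKey b₁) (labelKey b₂))) * hpow
      · rw [if_neg h2, if_neg fun h => h2 (hiff.1 h)]
        ring
    · intro A' _ hA'
      rw [weight_eq_coef, if_neg, zero_mul]
      exact fun h => hA' (h.top_unique h1)
    · simp

/-- All four terms share the same conservation condition and the same power of `p`, both being
symmetric in the two left labels and in the two right labels. Only the scalar identity is left. -/
theorem vertex_exchange [IsDomain R] {p : R} (hp : p ≠ 0) (x y : R)
    (d₁ d₂ b₁ b₂ : Option (Fin n)) (A C : Finset (Fin n)) :
    exchKeep p x y (labelKey d₁) (labelKey d₂) * (vertex p x d₁ b₁ * vertex p y d₂ b₂) A C +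
      exchSwap p x y (labelKey d₁) (labelKey d₂) * (vertex p x d₂ b₁ * vertex p y d₁ b₂) A C =
    exchKeep p x y (labelKey b₁) (labelKey b₂) * (vertex p y d₁ b₁ * vertex p x d₂ b₂) A C +
      exchSwap p x y (labelKey b₂) (labelKey b₁) * (vertex p y d₁ b₂ * vertex p x d₂ b₁) A C := by
  apply mul_left_cancel₀ hp
  classical
  simp only [mul_add, mul_left_comm p, vertex_mul_vertex]
  simp only [conservedTwo_comm_left A b₁ b₂ C d₁ d₂, conservedTwo_comm_right A b₁ b₂ C d₁ d₂]
  split_ifs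
  · linear_combination (p ^ aboveLabel A d₁ * p ^ aboveLabel A d₂) *
      coefTwo_exchange p x y (memKey A) (labelKey d₁) (labelKey d₂) (labelKey b₁) (labelKey b₂)
  · ring

theorem zeroRow_cons (p : R) (N : ℕ) (x : R) (d b : Option (Fin n)) (a c : Finset (Fin n))
    (A C : Fin N → Finset (Fin n)) :
    zeroRow p (N + 1) x d b (Fin.cons (α := fun _ => Finset (Fin n)) a A)
      (Fin.cons (α := fun _ => Finset (Fin n)) c C) =
      ∑ h, vertex p x d h a c * zeroRow p N x h b A C :=
  pathRow_cons _ _ _ _ _ _ _ _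

theorem zeroRow_mul_cons (p : R) (N : ℕ) (x y : R) (d₁ b₁ d₂ b₂ : Option (Fin n))
    (a c : Finset (Fin n)) (A C : Fin N → Finset (Fin n)) :
    (zeroRow p (N + 1) x d₁ b₁ * zeroRow p (N + 1) y d₂ b₂)
      (Fin.cons (α := fun _ => Finset (Fin n)) a A) (Fin.cons (α := fun _ => Finset (Fin n)) c C) =
      ∑ h₁, ∑ h₂, (vertex p x d₁ h₁ * vertex p y d₂ h₂) a c *
        (zeroRow p N x h₁ b₁ * zeroRow p N y h₂ b₂) A C := by
  rw [Matrix.mul_apply, ← (Fin.consEquiv fun _ : Fin (N + 1) => Finset (Fin n)).sum_comp,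
    Fintype.sum_prod_type]
  simp only [Fin.consEquiv, Equiv.coe_fn_mk, zeroRow_cons, Finset.sum_mul_sum, Matrix.mul_apply]
  have h : ∀ f : Finset (Fin n) → (Fin N → Finset (Fin n)) → Option (Fin n) → Option (Fin n) → R,
      ∑ s, ∑ S, ∑ h₁, ∑ h₂, f s S h₁ h₂ = ∑ h₁, ∑ h₂, ∑ s, ∑ S, f s S h₁ h₂ := by
    intro f
    calc _ = ∑ s, ∑ h₁, ∑ S, ∑ h₂, f s S h₁ h₂ :=
          Finset.sum_congr rfl fun s _ => Finset.sum_comm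
      _ = ∑ h₁, ∑ s, ∑ S, ∑ h₂, f s S h₁ h₂ := Finset.sum_comm
      _ = ∑ h₁, ∑ s, ∑ h₂, ∑ S, f s S h₁ h₂ :=
          Finset.sum_congr rfl fun h₁ _ => Finset.sum_congr rfl fun s _ => Finset.sum_comm
      _ = _ := Finset.sum_congr rfl fun h₁ _ => Finset.sum_comm
  rw [h]
  refine Finset.sum_congr rfl fun h₁ _ => Finset.sum_congr rfl fun h₂ _ =>
    Finset.sum_congr rfl fun s _ => Finset.sum_congr rfl fun S _ => ?_
  ring

/-- The zipper argument: the coefficients that come out on the right of one column are those needed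
on the left of the next, so the exchange passes through the columns one at a time. -/
theorem zeroRow_exchange [IsDomain R] {p : R} (hp : p ≠ 0) (x y : R) (N : ℕ)
    (d₁ d₂ b₁ b₂ : Option (Fin n)) :
    exchKeep p x y (labelKey d₁) (labelKey d₂) • (zeroRow p N x d₁ b₁ * zeroRow p N y d₂ b₂) +
      exchSwap p x y (labelKey d₁) (labelKey d₂) • (zeroRow p N x d₂ b₁ * zeroRow p N y d₁ b₂) =
    exchKeep p x y (labelKey b₁) (labelKey b₂) • (zeroRow p N y d₁ b₁ * zeroRow p N x d₂ b₂) +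
      exchSwap p x y (labelKey b₂) (labelKey b₁) •
        (zeroRow p N y d₁ b₂ * zeroRow p N x d₂ b₁) := by
  induction N generalizing d₁ d₂ b₁ b₂ with
  | zero =>
      have h : ∀ (z : R) (d b : Option (Fin n)),
          zeroRow p 0 z d b = (if d = b then (1 : R) else 0) • 1 := by
        intro z d b
        ext A C
        rw [zeroRow, pathRow_zero, Subsingleton.elim A C]
        simp
      simp only [h]
      by_cases h1 : d₁ = b₁ <;> by_cases h2 : d₂ = b₂ <;> by_cases h3 : d₁ = b₂ <;>
        by_cases h4 : d₂ = b₁ <;> simp_all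
  | succ N ih =>
      ext A C
      obtain ⟨a, A, rfl⟩ : ∃ a A', A = Fin.cons (α := fun _ => Finset (Fin n)) a A' :=
        ⟨A 0, Fin.tail A, (Fin.cons_self_tail A).symm⟩
      obtain ⟨c, C, rfl⟩ : ∃ b B', C = Fin.cons (α := fun _ => Finset (Fin n)) b B' :=
        ⟨C 0, Fin.tail C, (Fin.cons_self_tail C).symm⟩
      simp only [Matrix.add_apply, Matrix.smul_apply, zeroRow_mul_cons, smul_eq_mul]
      have ih' := fun h₁ h₂ => congrFun (congrFun (ih h₁ h₂ b₁ b₂) A) C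
      simp only [Matrix.add_apply, Matrix.smul_apply, smul_eq_mul] at ih'
      calc _ = ∑ h₁, ∑ h₂, (exchKeep p x y (labelKey d₁) (labelKey d₂) *
              (vertex p x d₁ h₁ * vertex p y d₂ h₂) a c +
            exchSwap p x y (labelKey d₁) (labelKey d₂) *
              (vertex p x d₂ h₁ * vertex p y d₁ h₂) a c) *
            (zeroRow p N x h₁ b₁ * zeroRow p N y h₂ b₂) A C := by
            simp only [Finset.mul_sum, ← Finset.sum_add_distrib]
            exact Finset.sum_congr rfl fun h₁ _ => Finset.sum_congr rfl fun h₂ _ => by ring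
        _ = ∑ h₁, ∑ h₂, exchKeep p x y (labelKey h₁) (labelKey h₂) *
              (vertex p y d₁ h₁ * vertex p x d₂ h₂) a c *
              (zeroRow p N x h₁ b₁ * zeroRow p N y h₂ b₂) A C +
            ∑ h₁, ∑ h₂, exchSwap p x y (labelKey h₂) (labelKey h₁) *
              (vertex p y d₁ h₂ * vertex p x d₂ h₁) a c *
              (zeroRow p N x h₁ b₁ * zeroRow p N y h₂ b₂) A C := by
            rw [← Finset.sum_add_distrib]
            refine Finset.sum_congr rfl fun h₁ _ => ?_
            rw [← Finset.sum_add_distrib]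
            refine Finset.sum_congr rfl fun h₂ _ => ?_
            linear_combination (zeroRow p N x h₁ b₁ * zeroRow p N y h₂ b₂) A C *
              vertex_exchange hp x y d₁ d₂ h₁ h₂ a c
        -- Renaming the inner labels in the swapped term gives both terms the same pair of vertices
        -- in the first column.
        _ = ∑ h₁, ∑ h₂, (vertex p y d₁ h₁ * vertex p x d₂ h₂) a c *
            (exchKeep p x y (labelKey h₁) (labelKey h₂) *
              (zeroRow p N x h₁ b₁ * zeroRow p N y h₂ b₂) A C +
            exchSwap p x y (labelKey h₁) (labelKey h₂) *
              (zeroRow p N x h₂ b₁ * zeroRow p N y h₁ b₂) A C) := by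
            rw [Finset.sum_comm (f := fun h₁ h₂ => exchSwap p x y (labelKey h₂) (labelKey h₁) *
              (vertex p y d₁ h₂ * vertex p x d₂ h₁) a c *
              (zeroRow p N x h₁ b₁ * zeroRow p N y h₂ b₂) A C)]
            simp only [← Finset.sum_add_distrib]
            exact Finset.sum_congr rfl fun h₁ _ => Finset.sum_congr rfl fun h₂ _ => by ring
        _ = _ := by
            simp only [ih', Finset.mul_sum, ← Finset.sum_add_distrib]
            exact Finset.sum_congr rfl fun h₁ _ => Finset.sum_congr rfl fun h₂ _ => by ring

end Exchange

/-! ### Words in row operators -/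

section Above

theorem above_erase_of_le (T : Finset (Fin n)) {i j : Fin n} (h : i ≤ j) :
    above (T.erase i) j = above T j := by
  unfold above
  congr 1
  ext c
  simp only [Finset.mem_filter, Finset.mem_erase]
  constructor
  · rintro ⟨⟨-, h1⟩, h2⟩
    exact ⟨h1, h2⟩
  · rintro ⟨h1, h2⟩
    exact ⟨⟨(lt_of_le_of_lt h h2).ne', h1⟩, h2⟩

theorem above_erase_of_lt {T : Finset (Fin n)} {i j : Fin n} (hi : i ∈ T) (h : j < i) :
    above (T.erase i) j + 1 = above T j := by
  unfold above
  rw [Finset.filter_erase, Finset.card_erase_add_one]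
  exact Finset.mem_filter.2 ⟨hi, h⟩

/-- The numbers of colours above the elements of `T` are 0, …, |T| - 1, each once. -/
theorem sum_pow_above {R : Type*} [CommRing R] (p : R) (T : Finset (Fin n)) :
    ∑ j ∈ T, p ^ above T j = ∑ r ∈ Finset.range T.card, p ^ r := by
  induction T using Finset.induction_on_min with
  | empty => simp
  | insert a s ha ih =>
    have has : a ∉ s := fun h => lt_irrefl _ (ha a h)
    have h1 : above (insert a s) a = s.card := by
      unfold above
      rw [Finset.filter_insert, if_neg (lt_irrefl a), Finset.filter_true_of_mem ha]
    have h2 : ∀ j ∈ s, above (insert a s) j = above s j := by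
      intro j hj
      unfold above
      rw [Finset.filter_insert, if_neg (ha j hj).not_gt]
    rw [Finset.sum_insert has, Finset.card_insert_of_notMem has, Finset.sum_range_succ, ← ih, h1,
      add_comm, Finset.sum_congr rfl fun j hj => by rw [h2 j hj]]

end Above

/-- The exchange relations between row operators `B i x`. -/
structure ExchangeRelations {R 𝒜 : Type*} [CommRing R] [Ring 𝒜] [Algebra R 𝒜] (p : R)
    (B : Fin n → R → 𝒜) : Prop where
  same : ∀ i x y, (y - p * x) • (B i x * B i y) = (x - p * y) • (B i y * B i x)
  lt : ∀ i j, i < j → ∀ x y, ((1 - p) * y) • (B i x * B j y) + (p * (x - y)) • (B j x * B i y) =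
    (x - p * y) • (B i y * B j x)
  gt : ∀ i j, j < i → ∀ x y, ((1 - p) * x) • (B i x * B j y) + (x - y) • (B j x * B i y) =
    (x - p * y) • (B i y * B j x)

/-- With both right labels empty, `exchSwap` vanishes on the right and a single term with
coefficient `x - p * y` survives. -/
theorem zeroRow_exchangeRelations {R : Type*} [CommRing R] [IsDomain R] {p : R} (hp : p ≠ 0)
    (N : ℕ) : ExchangeRelations (n := n) p (fun i x => zeroRow p N x (some i) none) where
  same i x y := by
    have := zeroRow_exchange hp x y N (some i) (some i) none none
    simpa [exchKeep, exchSwap, labelKey] using this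
  lt i j h x y := by
    have := zeroRow_exchange hp x y N (some i) (some j) none none
    have h1 : i ≠ j := h.ne
    simpa [exchKeep, exchSwap, labelKey, h, Fin.val_inj, h1] using this
  gt i j h x y := by
    have := zeroRow_exchange hp x y N (some i) (some j) none none
    have h1 : i ≠ j := h.ne'
    simpa [exchKeep, exchSwap, labelKey, h.not_gt, Fin.val_inj, h1] using this

section Words

variable {R 𝒜 : Type*} [CommRing R] [Ring 𝒜] [Algebra R 𝒜]

/-- The sum of the products of row operators with parameters `l` over all orders of the colours in
`T`. -/
def wordSum (B : Fin n → R → 𝒜) : List R → Finset (Fin n) → 𝒜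
  | [], T => if T = ∅ then 1 else 0
  | x :: l, T => ∑ c ∈ T, B c x * wordSum B l (T.erase c)

/-- The geometric progression `p ^ (k - 1) * t, …, p * t, t`. -/
def ladder (p t : R) : ℕ → List R
  | 0 => []
  | k + 1 => p ^ k * t :: ladder p t k

theorem exists_of_mem_ladder {p t x : R} {k : ℕ} (h : x ∈ ladder p t k) :
    ∃ j < k, x = p ^ j * t := by
  induction k with
  | zero => simp [ladder] at h
  | succ k ih =>
    rcases List.mem_cons.1 h with rfl | h
    · exact ⟨k, k.lt_succ_self, rfl⟩
    · obtain ⟨j, hj, e⟩ := ih h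
      exact ⟨j, hj.trans k.lt_succ_self, e⟩

omit [CommRing R] [Algebra R 𝒜] in
theorem wordSum_append_singleton (B : Fin n → R → 𝒜) (l : List R) (y : R) (T : Finset (Fin n)) :
    wordSum B (l ++ [y]) T = ∑ c ∈ T, wordSum B l (T.erase c) * B c y := by
  induction l generalizing T with
  | nil =>
    simp only [List.nil_append, wordSum]
    refine Finset.sum_congr rfl fun c _ => ?_
    split_ifs <;> simp
  | cons x l ih =>
    simp only [List.cons_append, wordSum, ih, Finset.mul_sum, Finset.sum_mul]
    rw [Finset.sum_comm' (t' := T) (s' := fun d => T.erase d)]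
    · refine Finset.sum_congr rfl fun d _ => Finset.sum_congr rfl fun c _ => ?_
      rw [Finset.erase_right_comm, mul_assoc]
    · intro c d
      simp only [Finset.mem_erase]
      tauto

theorem sum_erase_eq_sum_lt {M : Type*} [AddCommMonoid M] (T : Finset (Fin n))
    (f : Fin n → Fin n → M) :
    ∑ c ∈ T, ∑ d ∈ T.erase c, f c d = ∑ c ∈ T, ∑ d ∈ T with c < d, (f c d + f d c) := by
  have h : ∀ c ∈ T, ∑ d ∈ T.erase c, f c d =
      ∑ d ∈ T with c < d, f c d + ∑ d ∈ T with d < c, f c d := by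
    intro c hc
    rw [← Finset.sum_union]
    · refine Finset.sum_congr ?_ fun _ _ => rfl
      ext d
      simp only [Finset.mem_erase, Finset.mem_union, Finset.mem_filter, ne_eq]
      constructor
      · rintro ⟨h1, h2⟩
        rcases lt_or_gt_of_ne h1 with h | h
        · exact Or.inr ⟨h2, h⟩
        · exact Or.inl ⟨h2, h⟩
      · rintro (⟨h1, h2⟩ | ⟨h1, h2⟩)
        · exact ⟨h2.ne', h1⟩
        · exact ⟨h2.ne, h1⟩
    · rw [Finset.disjoint_filter]
      exact fun d _ h1 h2 => lt_asymm h1 h2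
  rw [Finset.sum_congr rfl h, Finset.sum_add_distrib]
  simp only [Finset.sum_add_distrib]
  congr 1
  refine Finset.sum_comm' fun c d => ?_
  simp only [Finset.mem_filter]
  tauto

variable [IsDomain R] [Module.IsTorsionFree R 𝒜] {p : R} {B : Fin n → R → 𝒜}

/-! ### Fusion along geometric progressions -/

namespace ExchangeRelations

/-- In the sum of the relations `lt` and `gt` every coefficient becomes `x - p * y`, which cancels.
-/
theorem symm (hB : ExchangeRelations p B) {x y : R} (h : x - p * y ≠ 0) {i j : Fin n}
    (hij : i < j) :
    B i x * B j y + B j x * B i y = B i y * B j x + B j y * B i x := by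
  apply smul_right_injective 𝒜 h
  simp only
  linear_combination (norm := module) hB.lt i j hij x y + hB.gt j i hij x y

theorem wordSum_swap (hB : ExchangeRelations p B) {x y : R} (h : x - p * y ≠ 0) (l : List R)
    (T : Finset (Fin n)) : wordSum B (x :: y :: l) T = wordSum B (y :: x :: l) T := by
  simp only [wordSum, Finset.mul_sum]
  rw [sum_erase_eq_sum_lt, sum_erase_eq_sum_lt]
  refine Finset.sum_congr rfl fun c _ => Finset.sum_congr rfl fun d hd => ?_
  rw [Finset.erase_right_comm (a := d) (b := c)]
  simp only [← mul_assoc, ← add_mul]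
  rw [hB.symm h (Finset.mem_filter.1 hd).2]

theorem wordSum_move (hB : ExchangeRelations p B) {y : R} {l : List R}
    (h : ∀ x ∈ l, x - p * y ≠ 0) (T : Finset (Fin n)) :
    wordSum B (l ++ [y]) T = wordSum B (y :: l) T := by
  induction l generalizing T with
  | nil => rfl
  | cons x l ih =>
    rw [← hB.wordSum_swap (h x (by simp))]
    simp only [List.cons_append]
    rw [wordSum, wordSum]
    refine Finset.sum_congr rfl fun c _ => ?_
    rw [ih fun x hx => h x (by simp [hx])]

/-- At `x = p * y` the right side of the exchange relation drops out, leaving a q-commutation of the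
colours. -/
theorem adjacent_lt (hB : ExchangeRelations p B) (hp1 : 1 - p ≠ 0) {y : R} (hy : y ≠ 0)
    {i j : Fin n} (hij : i < j) : B i (p * y) * B j y = p • (B j (p * y) * B i y) := by
  apply smul_right_injective 𝒜 (mul_ne_zero hp1 hy)
  simp only
  linear_combination (norm := module) hB.lt i j hij (p * y) y

theorem adjacent_same (hB : ExchangeRelations p B) (hp2 : 1 - p ^ 2 ≠ 0) {y : R} (hy : y ≠ 0)
    (i : Fin n) : B i (p * y) * B i y = 0 := by
  apply smul_right_injective 𝒜 (mul_ne_zero hp2 hy)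
  simp only
  linear_combination (norm := module) hB.same i (p * y) y

/-- The two recursions for `wordSum` along a geometric progression. -/
theorem wordSum_ladder_aux (hB : ExchangeRelations p B) (hp : p ≠ 0) (hp1 : 1 - p ≠ 0) {t : R}
    (ht : t ≠ 0) (k : ℕ) (T : Finset (Fin n)) (hT : T.card = k + 1) :
    (∀ i ∈ T, ∀ j ∈ T, i < j →
      p ^ above T j • (B i (p ^ k * t) * wordSum B (ladder p t k) (T.erase i)) =
      p ^ above T i • (B j (p ^ k * t) * wordSum B (ladder p t k) (T.erase j))) ∧
    ∀ i ∈ T, (∑ r ∈ Finset.range (k + 1), p ^ r) •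
      (B i (p ^ k * t) * wordSum B (ladder p t k) (T.erase i)) =
      p ^ above T i • wordSum B (ladder p t (k + 1)) T := by
  induction k generalizing T with
  | zero =>
    obtain ⟨a, rfl⟩ := Finset.card_eq_one.1 hT
    constructor
    · intro i hi j hj hij
      rw [Finset.mem_singleton.1 hi, Finset.mem_singleton.1 hj] at hij
      exact absurd hij (lt_irrefl a)
    · intro i hi
      obtain rfl := Finset.mem_singleton.1 hi
      simp [wordSum, ladder, above, Finset.filter_singleton]
  | succ k ih =>
    have key : ∀ i ∈ T, ∀ j ∈ T, i < j →
        p ^ above T j • (B i (p ^ (k + 1) * t) * wordSum B (ladder p t (k + 1)) (T.erase i)) =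
        p ^ above T i • (B j (p ^ (k + 1) * t) *
          wordSum B (ladder p t (k + 1)) (T.erase j)) := by
      intro i hi j hj hij
      have hji : j ∈ T.erase i := Finset.mem_erase.2 ⟨hij.ne', hj⟩
      have hij' : i ∈ T.erase j := Finset.mem_erase.2 ⟨hij.ne, hi⟩
      have h1 := (ih (T.erase i) (by rw [Finset.card_erase_of_mem hi, hT]; rfl)).2 j hji
      have h2 := (ih (T.erase j) (by rw [Finset.card_erase_of_mem hj, hT]; rfl)).2 i hij'
      rw [above_erase_of_le _ hij.le] at h1
      have h3 := hB.adjacent_lt hp1 (mul_ne_zero (pow_ne_zero k hp) ht) hij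
      rw [← mul_assoc, ← pow_succ'] at h3
      rw [Finset.erase_right_comm] at h1
      set W := wordSum B (ladder p t k) ((T.erase j).erase i)
      set g := ∑ r ∈ Finset.range (k + 1), p ^ r
      calc _ = B i (p ^ (k + 1) * t) * (g • (B j (p ^ k * t) * W)) := by rw [h1, mul_smul_comm]
        _ = p • (B j (p ^ (k + 1) * t) * (g • (B i (p ^ k * t) * W))) := by
          rw [mul_smul_comm, mul_smul_comm, ← mul_assoc, ← mul_assoc, h3, smul_mul_assoc,
            smul_comm]
        _ = _ := by
          rw [h2, mul_smul_comm, smul_smul, ← pow_succ', above_erase_of_lt hj hij]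
    refine ⟨key, fun i hi => ?_⟩
    rw [wordSum.eq_def _ (ladder p t (k + 1 + 1))]
    simp only [ladder]
    -- The geometric sum is written as the sum of the powers `p ^ above T j`, one for each possible
    -- first colour `j`, so that the claim can be compared term by term with `key`.
    rw [Finset.smul_sum, ← hT, ← sum_pow_above, Finset.sum_smul]
    refine Finset.sum_congr rfl fun j hj => ?_
    rcases lt_trichotomy i j with h | rfl | h
    · exact key i hi j hj h
    · rfl
    · exact (key j hj i hi h).symm

theorem smul_wordSum_ladder (hB : ExchangeRelations p B) (hp : p ≠ 0) (hp1 : 1 - p ≠ 0) {t : R}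
    (ht : t ≠ 0) {k : ℕ} {T : Finset (Fin n)} (hT : T.card = k + 1) {i : Fin n} (hi : i ∈ T) :
    (∑ r ∈ Finset.range (k + 1), p ^ r) •
      (B i (p ^ k * t) * wordSum B (ladder p t k) (T.erase i)) =
      p ^ above T i • wordSum B (ladder p t (k + 1)) T :=
  (hB.wordSum_ladder_aux hp hp1 ht k T hT).2 i hi

/-- Fusion lets the word sum start with the colour `i`, up to a scalar; two equal colours at ratio
`p` then annihilate. -/
theorem mul_wordSum_ladder_eq_zero (hB : ExchangeRelations p B) (hp : p ≠ 0) (hp1 : 1 - p ≠ 0)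
    (hp2 : 1 - p ^ 2 ≠ 0) {t : R} (ht : t ≠ 0) {k : ℕ} {S : Finset (Fin n)} (hS : S.card = k)
    {i : Fin n} (hi : i ∈ S) : B i (p ^ k * t) * wordSum B (ladder p t k) S = 0 := by
  obtain ⟨k, rfl⟩ : ∃ k', k = k' + 1 :=
    ⟨k - 1, by have := Finset.card_pos.2 ⟨i, hi⟩; omega⟩
  apply smul_right_injective 𝒜 (pow_ne_zero (above S i) hp)
  simp only
  rw [← mul_smul_comm, ← hB.smul_wordSum_ladder hp hp1 ht hS hi, mul_smul_comm, ← mul_assoc,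
    pow_succ', mul_assoc p, hB.adjacent_same hp2 (mul_ne_zero (pow_ne_zero k hp) ht), zero_mul,
    smul_zero, smul_zero]

/-- The parameter `p ^ k * t` is moved from the front to the back. The moves need `p ^ j * t ≠ p ^
(k + 1) * t` for `j < k`, so only the powers `p ^ 2, …, p ^ (k + 1)` must differ from 1. -/
theorem wordSum_ladder_succ (hB : ExchangeRelations p B) (hp : p ≠ 0) {t : R} (ht : t ≠ 0) {k : ℕ}
    (hk : ∀ r, 1 ≤ r → r ≤ k + 1 → 1 - p ^ r ≠ 0) (T : Finset (Fin n)) :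
    wordSum B (ladder p t (k + 1)) T =
      ∑ c ∈ T, wordSum B (ladder p t k) (T.erase c) * B c (p ^ k * t) := by
  rw [← wordSum_append_singleton, hB.wordSum_move]
  · rfl
  · intro x hx
    obtain ⟨j, hj, rfl⟩ := exists_of_mem_ladder hx
    have e : p ^ j * t - p * (p ^ k * t) = p ^ j * t * (1 - p ^ (k + 1 - j)) := by
      obtain ⟨d, rfl⟩ := Nat.exists_eq_add_of_lt hj
      rw [show j + d + 1 + 1 - j = d + 2 by omega]
      ring
    rw [e]
    exact mul_ne_zero (mul_ne_zero (pow_ne_zero j hp) ht) (hk _ (by omega) (by omega))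

/-- Moving `B i w` through the word would normally also produce terms with exchanged parameters. The
factor `B i (p ^ k * t)` in front kills them, since they start with two equal colours at ratio `p`;
only scalar factors remain. -/
theorem mul_mul_wordSum_ladder (hB : ExchangeRelations p B) (hp : p ≠ 0) (hp1 : 1 - p ≠ 0)
    (hp2 : 1 - p ^ 2 ≠ 0) {t : R} (ht : t ≠ 0) (w : R) {k : ℕ} {S : Finset (Fin n)}
    (hS : S.card = k) {i : Fin n} (hi : i ∉ S) :
    (∏ l ∈ Finset.range k, (p ^ l * t - p * w)) •
      (B i (p ^ k * t) * B i w * wordSum B (ladder p t k) S) =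
    (p ^ above S i * ∏ l ∈ Finset.range k, (p ^ l * t - w)) •
      (B i (p ^ k * t) * wordSum B (ladder p t k) S * B i w) := by
  induction k generalizing S with
  | zero =>
    obtain rfl := Finset.card_eq_zero.1 hS
    simp [ladder, wordSum, above]
  | succ k ih =>
    rw [ladder, wordSum]
    simp only [Finset.mul_sum, Finset.sum_mul, Finset.smul_sum]
    refine Finset.sum_congr rfl fun c hc => ?_
    have hic : i ≠ c := fun h => hi (h ▸ hc)
    have hu : p ^ k * t ≠ 0 := mul_ne_zero (pow_ne_zero k hp) ht
    have h0 := hB.adjacent_same hp2 hu i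
    have IH := ih (S := S.erase c) (by rw [Finset.card_erase_of_mem hc, hS]; rfl)
      fun h => hi (Finset.mem_of_mem_erase h)
    rw [Finset.prod_range_succ, Finset.prod_range_succ, pow_succ', mul_assoc p]
    set u := p ^ k * t
    set W := wordSum B (ladder p t k) (S.erase c)
    set P := ∏ l ∈ Finset.range k, (p ^ l * t - p * w)
    set Q := ∏ l ∈ Finset.range k, (p ^ l * t - w)
    have IHc := congrArg (B c (p * u) * ·) IH
    simp only [mul_smul_comm, ← mul_assoc] at IHc
    simp only [← mul_assoc]
    rcases lt_or_gt_of_ne hic with h | h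
    · have h1 := congrArg (B i (p * u) * · * W) (hB.lt i c h u w)
      simp only [mul_add, mul_smul_comm, smul_mul_assoc, ← mul_assoc, h0, zero_mul,
        smul_zero, zero_add] at h1
      have h2 := hB.adjacent_lt hp1 hu h
      rw [h2] at h1 ⊢
      rw [← above_erase_of_lt hc h]
      simp only [smul_mul_assoc] at h1 ⊢
      linear_combination (norm := module) (-P) • h1 + (p ^ 2 * (u - w)) • IHc
    · have h1 := congrArg (B i (p * u) * · * W) (hB.gt i c h u w)
      simp only [mul_add, mul_smul_comm, smul_mul_assoc, ← mul_assoc, h0, zero_mul,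
        smul_zero, zero_add] at h1
      have h2 := hB.adjacent_lt hp1 hu h
      rw [h2] at IHc
      rw [above_erase_of_le _ h.le] at IHc
      apply smul_right_injective 𝒜 hp
      simp only [smul_mul_assoc] at IHc ⊢
      linear_combination (norm := module) (-(p * P)) • h1 + (u - w) • IHc

/-- The sum over all orders of all colours along a geometric progression commutes with every row
operator, up to a scalar. -/
theorem mul_wordSum_univ (hB : ExchangeRelations p B) (hp : p ≠ 0) (hp1 : 1 - p ≠ 0)
    (hp2 : 1 - p ^ 2 ≠ 0) {t : R} (ht : t ≠ 0) (w : R)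
    (hw : ∀ l < n, p ^ l * t - w ≠ 0) (i : Fin n) :
    (p ^ (n - 1) * (t - p * w)) • (B i w * wordSum B (ladder p t n) Finset.univ) =
    (p ^ above Finset.univ i * (w - p ^ n * t)) •
      (wordSum B (ladder p t n) Finset.univ * B i w) := by
  obtain ⟨k, rfl⟩ : ∃ k, n = k + 1 := ⟨n - 1, by have := i.pos; omega⟩
  have hcard : (Finset.univ : Finset (Fin (k + 1))).card = k + 1 := by simp
  have hS : (Finset.univ.erase i).card = k := by simp
  have hiS : i ∉ Finset.univ.erase i := by simp
  have h1 := hB.smul_wordSum_ladder hp hp1 ht hcard (Finset.mem_univ i)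
  have h2 := hB.mul_mul_wordSum_ladder hp hp1 hp2 ht w hS hiS
  have h3 := hB.same i w (p ^ k * t)
  rw [above_erase_of_le _ le_rfl] at h2
  set E := wordSum B (ladder p t (k + 1)) Finset.univ
  set W := wordSum B (ladder p t k) (Finset.univ.erase i)
  set a := above Finset.univ i
  set g := ∑ r ∈ Finset.range (k + 1), p ^ r
  set P := ∏ l ∈ Finset.range k, (p ^ l * t - p * w) with hP
  set Q := ∏ l ∈ Finset.range k, (p ^ l * t - w) with hQ
  -- The left side is the product over `l ≤ k` of `p ^ l * t - p * w`; all factors but the one for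
  -- `l = 0` are `p` times a factor of `Q`.
  have hPQ : P * (p ^ k * t - p * w) = (t - p * w) * (p ^ k * Q) := by
    rw [hP, hQ, ← Finset.prod_range_succ (fun l => p ^ l * t - p * w), Finset.prod_range_succ',
      mul_comm, pow_zero, one_mul]
    have : p ^ k * ∏ l ∈ Finset.range k, (p ^ l * t - w) =
        ∏ l ∈ Finset.range k, p * (p ^ l * t - w) := by
      rw [Finset.prod_mul_distrib, Finset.prod_const, Finset.card_range]
    rw [this]
    congr 1
    exact Finset.prod_congr rfl fun l _ => by ring
  have hQ0 : Q ≠ 0 := Finset.prod_ne_zero_iff.2 fun l hl =>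
    hw l ((Finset.mem_range.1 hl).trans k.lt_succ_self)
  apply smul_right_injective 𝒜 (mul_ne_zero (pow_ne_zero a hp) hQ0)
  have e1 := congrArg (B i w * ·) h1
  have e2 := congrArg (· * W) h3
  have e3 := congrArg (· * B i w) h1
  simp only [mul_smul_comm, smul_mul_assoc, ← mul_assoc] at e1 e2 e3
  simp only [Nat.add_sub_cancel]
  calc _ = (P * (p ^ k * t - p * w)) • (p ^ a • (B i w * E)) := by
        rw [hPQ]; module
    _ = ((w - p * (p ^ k * t)) * g) • (P • (B i (p ^ k * t) * B i w * W)) := by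
        rw [← e1]
        linear_combination (norm := module) (P * g) • e2
    _ = _ := by
        rw [h2]
        linear_combination (norm := module) ((w - p * (p ^ k * t)) * p ^ a * Q) • e3


end ExchangeRelations
end Words

/-! ### Evaluation at the bottom of the geometric progression -/

section Boundary

variable {R : Type*} [CommRing R]

theorem vertex_some_univ (p x : R) (c : Fin n) (h : Option (Fin n)) :
    vertex p x (some c) h Finset.univ Finset.univ =
      if h = some c then -(x * p ^ above Finset.univ c) else 0 := by
  simp only [vertex, Matrix.of_apply]
  by_cases hc : h = some c
  · subst hc
    have hc : Conserved Finset.univ (some c) Finset.univ (some c) := fun d => rfl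
    rw [if_pos rfl, weight, if_pos hc]
    simp [weightTable, occ]
  · rw [if_neg hc]
    apply weight_of_not_conserved
    intro H
    have := H c
    simp only [unitVec, hc, if_false, if_true] at this
    omega

theorem vertex_some_eq_zero (p x : R) (c : Fin n) (h : Option (Fin n)) {A C : Finset (Fin n)}
    (hAC : A.card < C.card) : vertex p x (some c) h A C = 0 := by
  apply weight_of_not_conserved
  intro H
  have := H.card
  have h1 : edgeCount h ≤ 1 := by unfold edgeCount; split_ifs <;> omega
  simp only [edgeCount, reduceCtorEq, if_false] at this h1
  omega

theorem zeroRow_some_eq_zero (p x : R) (N : ℕ) (c : Fin n) {a b : Finset (Fin n)}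
    (hab : a.card < b.card) (A C : Fin N → Finset (Fin n)) (j : Option (Fin n)) :
    zeroRow p (N + 1) x (some c) j (Fin.cons (α := fun _ => Finset (Fin n)) a A)
      (Fin.cons (α := fun _ => Finset (Fin n)) b C) = 0 := by
  rw [zeroRow_cons]
  exact Finset.sum_eq_zero fun h _ => by rw [vertex_some_eq_zero p x c h hab, zero_mul]

theorem sum_cons {M : Type*} [AddCommMonoid M] (N : ℕ) (f : (Fin (N + 1) → Finset (Fin n)) → M) :
    ∑ A, f A = ∑ a, ∑ A, f (Fin.cons (α := fun _ => Finset (Fin n)) a A) := by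
  rw [← (Fin.consEquiv fun _ : Fin (N + 1) => Finset (Fin n)).sum_comp, Fintype.sum_prod_type]
  rfl

/-- In each row a path leaves column 0 to the left and at most one enters it from the right, so the
column cannot gain colours and never becomes full again. -/
theorem prod_zeroRow_eq_zero (p : R) (N : ℕ) (l : List (Fin n × R)) {a : Finset (Fin n)}
    (ha : a ≠ Finset.univ) (A C : Fin N → Finset (Fin n)) :
    (l.map fun b => zeroRow p (N + 1) b.2 (some b.1) none).prod
      (Fin.cons (α := fun _ => Finset (Fin n)) a A)
      (Fin.cons (α := fun _ => Finset (Fin n)) Finset.univ C) = 0 := by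
  induction l generalizing a A with
  | nil =>
    rw [List.map_nil, List.prod_nil, Matrix.one_apply_ne]
    intro h
    exact ha (by simpa using congrFun h 0)
  | cons b l ih =>
    rw [List.map_cons, List.prod_cons, Matrix.mul_apply, sum_cons]
    refine Finset.sum_eq_zero fun d _ => Finset.sum_eq_zero fun D _ => ?_
    by_cases hd : d = Finset.univ
    · have : a.card < d.card := by
        rw [hd]
        exact Finset.card_lt_card (Finset.ssubset_univ_iff.2 ha)
      rw [zeroRow_some_eq_zero p b.2 N b.1 this, zero_mul]
    · rw [ih hd, mul_zero]

/-- A full column that stays full is rigid. -/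
theorem prod_zeroRow_cons_univ (p : R) (N : ℕ) (l : List (Fin n × R))
    (A C : Fin N → Finset (Fin n)) :
    (l.map fun b => zeroRow p (N + 1) b.2 (some b.1) none).prod
      (Fin.cons (α := fun _ => Finset (Fin n)) Finset.univ A)
      (Fin.cons (α := fun _ => Finset (Fin n)) Finset.univ C) =
    (l.map fun b => -(b.2 * p ^ above Finset.univ b.1)).prod *
      (l.map fun b => zeroRow p N b.2 (some b.1) none).prod A C := by
  induction l generalizing A with
  | nil =>
    by_cases h : A = C
    · subst h
      simp
    · rw [List.map_nil, List.prod_nil, Matrix.one_apply_ne, List.map_nil, List.map_nil,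
        List.prod_nil, List.prod_nil, Matrix.one_apply_ne h, mul_zero]
      exact fun h' => h (Fin.cons_injective2 h').2
  | cons b l ih =>
    rw [List.map_cons, List.prod_cons, Matrix.mul_apply, sum_cons,
      Finset.sum_eq_single Finset.univ]
    · simp only [List.map_cons, List.prod_cons, Matrix.mul_apply, ih, Finset.mul_sum]
      refine Finset.sum_congr rfl fun D _ => ?_
      rw [zeroRow_cons, Finset.sum_eq_single (some b.1)]
      · rw [vertex_some_univ, if_pos rfl]
        ring
      · intro h _ hb
        rw [vertex_some_univ, if_neg hb, zero_mul]
      · simp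
    · intro d _ hd
      exact Finset.sum_eq_zero fun D _ => by rw [prod_zeroRow_eq_zero p N l hd, mul_zero]
    · simp

/-- Every weight with a path entering from the right is a multiple of `x`. At parameter 0 different
columns therefore decouple. -/
theorem vertex_zero_some (p : R) (d : Option (Fin n)) (b : Fin n) (A C : Finset (Fin n)) :
    vertex p 0 d (some b) A C = 0 := by
  simp only [vertex, Matrix.of_apply, weight]
  split_ifs
  · cases d with
    | none => simp [weightTable]
    | some d => simp only [weightTable]; split_ifs <;> simp
  · rfl

theorem zeroRow_zero_cons (p : R) (N : ℕ) (d b : Option (Fin n)) (a c : Finset (Fin n))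
    (A C : Fin N → Finset (Fin n)) :
    zeroRow p (N + 1) 0 d b (Fin.cons (α := fun _ => Finset (Fin n)) a A)
      (Fin.cons (α := fun _ => Finset (Fin n)) c C) =
      vertex p 0 d none a c * zeroRow p N 0 none b A C := by
  rw [zeroRow_cons, Finset.sum_eq_single none]
  · intro h _ hn
    obtain ⟨h, rfl⟩ := Option.ne_none_iff_exists'.1 hn
    rw [vertex_zero_some, zero_mul]
  · simp

theorem cons_eq_const {N : ℕ} (a : Finset (Fin n)) : (fun _ : Fin (N + 1) => a) =
    Fin.cons (α := fun _ => Finset (Fin n)) a (fun _ : Fin N => a) := by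
  funext k
  refine Fin.cases rfl (fun k => rfl) k

theorem conserved_none_iff {A C : Finset (Fin n)} : Conserved A none C none ↔ A = C := by
  constructor
  · intro h
    ext c
    have := h c
    simp only [occ, unitVec, reduceCtorEq, if_false, add_zero] at this
    split_ifs at this <;> simp_all
  · rintro rfl c
    rfl

theorem conserved_none_some_iff {A C : Finset (Fin n)} {d : Fin n} :
    Conserved A none C (some d) ↔ d ∉ C ∧ A = insert d C := by
  constructor
  · intro h
    have key : ∀ c, (c = d → c ∈ A ∧ c ∉ C) ∧ (c ≠ d → (c ∈ A ↔ c ∈ C)) := by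
      intro c
      have := h c
      simp only [occ, unitVec, reduceCtorEq, if_false, add_zero, Option.some.injEq] at this
      refine ⟨fun hc => ?_, fun hc => ?_⟩
      · subst hc
        by_cases h1 : c ∈ A <;> by_cases h2 : c ∈ C <;> simp_all
      · have hc' : d ≠ c := Ne.symm hc
        by_cases h1 : c ∈ A <;> by_cases h2 : c ∈ C <;> simp_all
    refine ⟨((key d).1 rfl).2, ?_⟩
    ext c
    rw [Finset.mem_insert]
    by_cases hc : c = d
    · subst hc
      simp [((key c).1 rfl).1]
    · rw [(key c).2 hc]
      simp [hc]
  · rintro ⟨hd, rfl⟩ c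
    by_cases hc : d = c
    · subst hc
      simp [occ, unitVec, hd]
    · simp [occ, unitVec, hc, Ne.symm hc]

theorem zeroRow_zero_none_empty (p : R) (N : ℕ) (A : Fin N → Finset (Fin n)) :
    zeroRow p N 0 none none A (fun _ => ∅) = if A = (fun _ => ∅) then 1 else 0 := by
  induction N with
  | zero =>
    rw [zeroRow, pathRow_zero, if_pos rfl, if_pos (Subsingleton.elim _ _)]
  | succ N ih =>
    obtain ⟨a, A, rfl⟩ : ∃ a A', A = Fin.cons (α := fun _ => Finset (Fin n)) a A' :=
      ⟨A 0, Fin.tail A, (Fin.cons_self_tail A).symm⟩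
    rw [cons_eq_const, zeroRow_zero_cons, ih, vertex, Matrix.of_apply, weight]
    simp only [Fin.cons_inj, conserved_none_iff]
    by_cases h1 : a = ∅ <;> by_cases h2 : A = fun _ => ∅ <;> simp [h1, h2, weightTable]

theorem ladder_zero (p : R) (k : ℕ) : ladder p 0 (k + 1) = 0 :: ladder p 0 k := by
  simp [ladder]

/-- At parameter 0 a path can exit on the left only from column 0, so all of `T` sits there.
Removing the colour `c` costs `(1 - p) * p ^ above T c`, and these costs add up to `1 - p ^ |T|`. -/
theorem wordSum_ladder_zero (p : R) (N k : ℕ) (T : Finset (Fin n)) (hT : T.card = k)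
    (A : Fin (N + 1) → Finset (Fin n)) :
    wordSum (fun i x => zeroRow p (N + 1) x (some i) none) (ladder p 0 k) T A (fun _ => ∅) =
      if A = Fin.cons (α := fun _ => Finset (Fin n)) T (fun _ => ∅) then
        ∏ r ∈ Finset.range k, (1 - p ^ (r + 1)) else 0 := by
  induction k generalizing T A with
  | zero =>
    obtain rfl := Finset.card_eq_zero.1 hT
    rw [← cons_eq_const]
    simp [ladder, wordSum, Matrix.one_apply]
  | succ k ih =>
    rw [ladder_zero, wordSum, Matrix.sum_apply]
    have h1 : ∀ c ∈ T, (zeroRow p (N + 1) 0 (some c) none * wordSum (fun i x =>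
        zeroRow p (N + 1) x (some i) none) (ladder p 0 k) (T.erase c)) A (fun _ => ∅) =
        (if A = Fin.cons (α := fun _ => Finset (Fin n)) T (fun _ => ∅) then
          (1 - p) * p ^ above T c else 0) * ∏ r ∈ Finset.range k, (1 - p ^ (r + 1)) := by
      intro c hc
      have hcard : (T.erase c).card = k := by rw [Finset.card_erase_of_mem hc, hT]; rfl
      rw [Matrix.mul_apply]
      simp only [ih _ hcard, mul_ite, mul_zero, Finset.sum_ite_eq', Finset.mem_univ, if_true]
      congr 1
      obtain ⟨a, A, rfl⟩ : ∃ a A', A = Fin.cons (α := fun _ => Finset (Fin n)) a A' :=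
        ⟨A 0, Fin.tail A, (Fin.cons_self_tail A).symm⟩
      rw [zeroRow_zero_cons, zeroRow_zero_none_empty, vertex, Matrix.of_apply, weight]
      simp only [Fin.cons_inj, conserved_none_some_iff, Finset.insert_erase hc]
      by_cases h2 : a = T <;> by_cases h3 : A = fun _ => ∅ <;> simp [h2, h3, weightTable, occ, hc]
    rw [Finset.sum_congr rfl h1, ← Finset.sum_mul]
    split_ifs
    · rw [← Finset.mul_sum, sum_pow_above, hT, Finset.prod_range_succ, mul_comm (1 - p),
        geom_sum_mul_neg, mul_comm]
    · simp

/-- The partition function with an additional column, and with all colours leaving in additional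
rows at the top with parameters `p ^ (n - 1) * t, …, p * t, t`. -/
def extendedLimit (n m : ℕ) (p t : R) (l : List (Fin n × R)) : R :=
  ((l.map fun b : Fin n × R => zeroRow p (m + 1) b.2 (some b.1) none).prod *
    wordSum (fun i x => zeroRow p (m + 1) x (some i) none) (ladder p t n) Finset.univ :
      Matrix (Fin (m + 1) → Finset (Fin n)) (Fin (m + 1) → Finset (Fin n)) R)
    (fun _ => Finset.univ) (fun _ => ∅)

/-- At `t = 0` the additional rows demand a full column 0 and empty columns elsewhere. Column 0 then
stays full through all lower rows and contributes a scalar, and the other `m` columns form `gLimit`.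
-/
theorem extendedLimit_zero (m : ℕ) (p : R) (l : List (Fin n × R)) :
    extendedLimit n m p 0 l = (∏ r ∈ Finset.range n, (1 - p ^ (r + 1))) *
      (l.map fun b => -(b.2 * p ^ above Finset.univ b.1)).prod * gLimit n m p l := by
  rw [extendedLimit, Matrix.mul_apply]
  have h := wordSum_ladder_zero p m n (Finset.univ : Finset (Fin n)) (Finset.card_fin n)
  rw [Finset.sum_eq_single (Fin.cons (α := fun _ => Finset (Fin n)) Finset.univ (fun _ => ∅))]
  · rw [h, if_pos rfl, cons_eq_const, prod_zeroRow_cons_univ, gLimit]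
    ring
  · intro A _ hA
    rw [h, if_neg hA, mul_zero]
  · simp

/-! ### Compatibility with ring homomorphisms -/

section Map

variable {S : Type*} [CommRing S] (f : R →+* S)

theorem map_ladder (p t : R) (k : ℕ) : (ladder p t k).map f = ladder (f p) (f t) k := by
  induction k with
  | zero => rfl
  | succ k ih => simp [ladder, ih]

theorem map_wordSum (p : R) (N : ℕ) (l : List R) (T : Finset (Fin n)) :
    f.mapMatrix (wordSum (fun i x => zeroRow p N x (some i) none) l T) =
      wordSum (fun i x => zeroRow (f p) N x (some i) none) (l.map f) T := by
  induction l generalizing T with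
  | nil =>
    simp only [wordSum, List.map_nil]
    split_ifs <;> simp
  | cons x l ih =>
    simp only [wordSum, List.map_cons, map_sum, map_mul, ih]
    refine Finset.sum_congr rfl fun c _ => ?_
    rw [RingHom.mapMatrix_apply, map_zeroRow]

theorem map_prod_zeroRow (p : R) (N : ℕ) (l : List (Fin n × R)) :
    f.mapMatrix (l.map fun b => zeroRow p N b.2 (some b.1) none).prod =
      ((l.map fun b => (b.1, f b.2)).map fun b => zeroRow (f p) N b.2 (some b.1) none).prod := by
  rw [map_list_prod, List.map_map, List.map_map]
  congr 1
  refine List.map_congr_left fun b _ => ?_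
  simp only [Function.comp, RingHom.mapMatrix_apply, map_zeroRow]

theorem map_gLimit (m : ℕ) (p : R) (l : List (Fin n × R)) :
    f (gLimit n m p l) = gLimit n m (f p) (l.map fun b => (b.1, f b.2)) := by
  rw [gLimit, gLimit, ← map_prod_zeroRow]
  rfl

theorem map_extendedLimit (m : ℕ) (p t : R) (l : List (Fin n × R)) :
    f (extendedLimit n m p t l) =
      extendedLimit n m (f p) (f t) (l.map fun b => (b.1, f b.2)) := by
  rw [extendedLimit, extendedLimit, ← map_prod_zeroRow, ← map_ladder, ← map_wordSum, ← map_mul]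
  rfl

end Map
end Boundary

/-! ### The partition function with an additional column -/

section Degree

variable {F : Type*} [CommRing F]

theorem natDegree_vertex_le (p a : F) (A D : Finset (Fin n)) (b d : Option (Fin n)) :
    (vertex (Polynomial.C p) (Polynomial.C a * Polynomial.X) d b A D).natDegree ≤ edgeCount b := by
  have h : vertex (Polynomial.C p) (Polynomial.C a * Polynomial.X) d b A D =
      (Polynomial.C (weight p a A b D d) * Polynomial.X ^ edgeCount b : Polynomial F) := by
    rw [vertex, Matrix.of_apply, mul_comm, weight_mul, ← map_weight, mul_comm]
  rw [h]
  exact Polynomial.natDegree_C_mul_X_pow_le _ _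

/-- Each occupied edge to the right of a vertex costs one degree. Of the `N` such edges the last is
empty, which saves one; this makes the degree bound for the extended partition function sharp
enough. -/
theorem natDegree_zeroRow_le (p a : F) (N : ℕ) (d : Option (Fin n)) (A D : Fin N → Finset (Fin n)) :
    (zeroRow (Polynomial.C p) N (Polynomial.C a * Polynomial.X) d none A D).natDegree ≤ N - 1 := by
  induction N generalizing d with
  | zero =>
    rw [zeroRow, pathRow_zero]
    split_ifs <;> simp
  | succ N ih =>
    obtain ⟨a', A, rfl⟩ : ∃ a A', A = Fin.cons (α := fun _ => Finset (Fin n)) a A' :=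
      ⟨A 0, Fin.tail A, (Fin.cons_self_tail A).symm⟩
    obtain ⟨b, D, rfl⟩ : ∃ b B', D = Fin.cons (α := fun _ => Finset (Fin n)) b B' :=
      ⟨D 0, Fin.tail D, (Fin.cons_self_tail D).symm⟩
    rw [zeroRow_cons]
    refine Polynomial.natDegree_sum_le_of_forall_le _ _ fun h _ => ?_
    have h1 := natDegree_vertex_le p a a' b h d
    have h2 := ih h A D
    rcases N with _ | N
    · rcases h with _ | c
      · refine Polynomial.natDegree_mul_le.trans ?_
        simp only [edgeCount, if_true] at h1
        omega
      · rw [zeroRow, pathRow_zero, if_neg (by simp), mul_zero]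
        simp
    · refine Polynomial.natDegree_mul_le.trans ?_
      have h3 : edgeCount h ≤ 1 := by unfold edgeCount; split_ifs <;> omega
      omega

theorem natDegree_wordSum_le (p : F) (m : ℕ) (l : List F) (T : Finset (Fin n))
    (A D : Fin (m + 1) → Finset (Fin n)) :
    (wordSum (fun i x => zeroRow (Polynomial.C p) (m + 1) x (some i) none)
      (l.map fun a => Polynomial.C a * Polynomial.X) T A D).natDegree ≤ l.length * m := by
  induction l generalizing T A with
  | nil =>
    simp only [List.map_nil, wordSum, List.length_nil, zero_mul]
    split_ifs
    · by_cases h : A = D <;> simp [Matrix.one_apply, h]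
    · simp
  | cons a l ih =>
    rw [List.map_cons, wordSum, Matrix.sum_apply]
    refine Polynomial.natDegree_sum_le_of_forall_le _ _ fun c _ => ?_
    rw [Matrix.mul_apply]
    refine Polynomial.natDegree_sum_le_of_forall_le _ _ fun E _ => ?_
    refine Polynomial.natDegree_mul_le.trans ?_
    have h1 := natDegree_zeroRow_le p a (m + 1) (some c) A E
    have h2 := ih (T.erase c) E
    rw [List.length_cons, add_mul, one_mul]
    omega

theorem ladder_X (p : F) (k : ℕ) : ladder (Polynomial.C p) Polynomial.X k =
    (ladder p 1 k).map fun a => Polynomial.C a * Polynomial.X := by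
  induction k with
  | zero => rfl
  | succ k ih => simp [ladder, ih]

theorem length_ladder (p t : F) (k : ℕ) : (ladder p t k).length = k := by
  induction k with
  | zero => rfl
  | succ k ih => simp [ladder, ih]

/-- The partition function with an additional column as a polynomial in the parameter `t`. -/
noncomputable def extendedPoly (n m : ℕ) (p : F) (l : List (Fin n × F)) : Polynomial F :=
  extendedLimit n m (Polynomial.C p) Polynomial.X (l.map fun b => (b.1, Polynomial.C b.2))

theorem eval_extendedPoly (m : ℕ) (p t : F) (l : List (Fin n × F)) :
    (extendedPoly n m p l).eval t = extendedLimit n m p t l := by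
  rw [extendedPoly, ← Polynomial.coe_evalRingHom, map_extendedLimit]
  simp [Function.comp_def]

theorem natDegree_extendedPoly_le (m : ℕ) (p : F) (l : List (Fin n × F)) :
    (extendedPoly n m p l).natDegree ≤ n * m := by
  rw [extendedPoly, extendedLimit, ← map_prod_zeroRow, Matrix.mul_apply]
  refine Polynomial.natDegree_sum_le_of_forall_le _ _ fun E _ => ?_
  refine Polynomial.natDegree_mul_le.trans ?_
  have h := natDegree_wordSum_le p m (ladder p 1 n) (Finset.univ : Finset (Fin n)) E (fun _ => ∅)
  rw [← ladder_X, length_ladder] at h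
  rw [RingHom.mapMatrix_apply, Matrix.map_apply, Polynomial.natDegree_C, zero_add]
  exact h

end Degree

/-! ### Linear factors in t and removal of the additional column -/

section Factor

theorem eval_one_of_dvd {F ι : Type*} [Field F] (s : Finset ι) (r : ι → F) (P : Polynomial F)
    (hdeg : P.natDegree ≤ s.card) (hdvd : ∏ a ∈ s, (Polynomial.X - Polynomial.C (r a)) ∣ P) :
    P.eval 1 * ∏ a ∈ s, -r a = P.eval 0 * ∏ a ∈ s, (1 - r a) := by
  obtain ⟨Q, rfl⟩ := hdvd
  by_cases hQ : Q = 0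
  · simp [hQ]
  · have hm := Polynomial.monic_prod_of_monic s (fun a => Polynomial.X - Polynomial.C (r a))
      fun a _ => Polynomial.monic_X_sub_C _
    rw [hm.natDegree_mul' hQ, Polynomial.natDegree_prod_of_monic _ _
      fun a _ => Polynomial.monic_X_sub_C _] at hdeg
    simp only [Polynomial.natDegree_X_sub_C, Finset.sum_const, smul_eq_mul, mul_one] at hdeg
    obtain ⟨c, rfl⟩ : ∃ c, Q = Polynomial.C c :=
      ⟨_, Polynomial.eq_C_of_natDegree_eq_zero (by omega)⟩
    simp only [Polynomial.eval_mul, Polynomial.eval_prod, Polynomial.eval_sub, Polynomial.eval_X,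
      Polynomial.eval_C, zero_sub]
    ring

instance matrix_isTorsionFree {R α : Type*} [CommRing R] [IsDomain R] [Fintype α] [DecidableEq α] :
    Module.IsTorsionFree R (Matrix α α R) :=
  inferInstanceAs (Module.IsTorsionFree R (α → α → R))

/-- Additional full rows commute with row operators, up to a scalar. -/
theorem prod_smul_mul_wordSum {R : Type*} [CommRing R] [IsDomain R] {p : R} (hp : p ≠ 0)
    (hp1 : 1 - p ≠ 0) (hp2 : 1 - p ^ 2 ≠ 0) {t : R} (ht : t ≠ 0) (N : ℕ) (l : List (Fin n × R))
    (hw : ∀ b ∈ l, ∀ r < n, p ^ r * t - b.2 ≠ 0) :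
    (l.map fun b => p ^ (n - 1) * (t - p * b.2)).prod •
      ((l.map fun b => zeroRow p N b.2 (some b.1) none).prod *
        wordSum (fun i x => zeroRow p N x (some i) none) (ladder p t n) Finset.univ) =
    (l.map fun b => p ^ above Finset.univ b.1 * (b.2 - p ^ n * t)).prod •
      (wordSum (fun i x => zeroRow p N x (some i) none) (ladder p t n) Finset.univ *
        (l.map fun b => zeroRow p N b.2 (some b.1) none).prod) := by
  induction l with
  | nil => simp
  | cons b l ih =>
    have ih' := ih fun b hb => hw b (by simp [hb])
    have h := (zeroRow_exchangeRelations (n := n) hp N).mul_wordSum_univ hp hp1 hp2 ht b.2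
      (hw b (by simp)) b.1
    simp only [List.map_cons, List.prod_cons]
    set E := wordSum (fun i x => zeroRow p N x (some i) none) (ladder p t n)
      (Finset.univ : Finset (Fin n))
    set P := (l.map fun b => zeroRow p N b.2 (some b.1) none).prod
    generalize p ^ (n - 1) * (t - p * b.2) = u at h ⊢
    generalize p ^ above Finset.univ b.1 * (b.2 - p ^ n * t) = v at h ⊢
    rw [mul_assoc, mul_smul, ← mul_smul_comm, ih', mul_smul_comm, ← mul_assoc, smul_comm,
      ← smul_mul_assoc, h, smul_mul_assoc, smul_smul, mul_assoc, mul_comm]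

theorem C_pow_mul_X_sub_ne_zero {F : Type*} [Field F] {p : F} (hp : p ≠ 0) (r : ℕ) (w : F) :
    Polynomial.C p ^ r * Polynomial.X - Polynomial.C w ≠ (0 : Polynomial F) := by
  intro h
  have h1 := congrArg (fun f => Polynomial.coeff f 1) h
  simp only [← Polynomial.C_pow, Polynomial.coeff_sub, Polynomial.coeff_C_mul,
    Polynomial.coeff_X_one, Polynomial.coeff_C_succ, Polynomial.coeff_zero, mul_one,
    sub_zero] at h1
  exact pow_ne_zero r hp h1

/-- Commuting the additional rows below all others exhibits `n * m` roots of a polynomial in `t` of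
degree at most `n * m`. It is thus a constant times a known product, and its value at 1 follows from
the one at 0. -/
theorem extendedLimit_one_of_field {F : Type*} [Field F] {p : F} (hp : p ≠ 0)
    (hp1 : ∀ k, 1 ≤ k → p ^ k ≠ 1) (m : ℕ) (σ : Fin (n * m) → Fin n) (e : Fin (n * m) → ℕ)
    (he : ∀ a, e a < n) :
    extendedLimit n m p 1 (List.ofFn fun a => (σ a, p ^ e a)) =
      (∏ r ∈ Finset.range n, (1 - p ^ (r + 1))) *
        (∏ a, p ^ above Finset.univ (σ a) * (p ^ n - p ^ e a)) *
        gLimit n m p (List.ofFn fun a => (σ a, p ^ e a)) := by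
  have hpn := pow_ne_zero n hp
  have hpC : Polynomial.C p ≠ 0 := by simpa using hp
  have h1 : ∀ k, 1 ≤ k → 1 - Polynomial.C p ^ k ≠ 0 := by
    intro k hk h
    rw [← Polynomial.C_pow, ← Polynomial.C_1, ← Polynomial.C_sub, Polynomial.C_eq_zero,
      sub_eq_zero] at h
    exact hp1 k hk h.symm
  have key := prod_smul_mul_wordSum hpC (by simpa using h1 1 le_rfl) (h1 2 (by omega))
    Polynomial.X_ne_zero (m + 1) (List.ofFn fun a => (σ a, Polynomial.C (p ^ e a)))
    (by
      intro b hb r _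
      obtain ⟨a, rfl⟩ := (List.mem_ofFn' _ _).1 hb
      exact C_pow_mul_X_sub_ne_zero hp _ _)
  have hprod : ∀ g : Fin n × Polynomial F → Polynomial F,
      ((List.ofFn fun a => (σ a, Polynomial.C (p ^ e a))).map g).prod =
        ∏ a, g (σ a, Polynomial.C (p ^ e a)) := fun g => by
    rw [List.map_ofFn, List.prod_ofFn]
    rfl
  have hP : extendedPoly n m p (List.ofFn fun a => (σ a, p ^ e a)) =
      extendedLimit n m (Polynomial.C p) Polynomial.X
        (List.ofFn fun a => (σ a, Polynomial.C (p ^ e a))) := by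
    rw [extendedPoly, List.map_ofFn]
    rfl
  obtain ⟨P', hentry⟩ : ∃ P', (∏ a, Polynomial.C p ^ (n - 1) *
      (Polynomial.X - Polynomial.C p * Polynomial.C (p ^ e a))) *
        extendedPoly n m p (List.ofFn fun a => (σ a, p ^ e a)) =
      (∏ a, Polynomial.C p ^ above Finset.univ (σ a) *
        (Polynomial.C (p ^ e a) - Polynomial.C p ^ n * Polynomial.X)) * P' := by
    rw [hprod, hprod] at key
    exact ⟨_, by rw [hP]; exact congrFun (congrFun key (fun _ => Finset.univ)) (fun _ => ∅)⟩
  have hdvd : ∏ a, (Polynomial.X - Polynomial.C (p ^ e a / p ^ n)) ∣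
      extendedPoly n m p (List.ofFn fun a => (σ a, p ^ e a)) := by
    -- The roots on one side are powers of `p` with exponents `e a - n < 0`, on the other with
    -- exponents `e b + 1 > 0`. A coincidence would make `p` a root of unity.
    have hcop : IsCoprime (∏ a, (Polynomial.X - Polynomial.C (p ^ e a / p ^ n)))
        (∏ a, Polynomial.C p ^ (n - 1) *
          (Polynomial.X - Polynomial.C p * Polynomial.C (p ^ e a))) := by
      refine IsCoprime.prod_left fun a _ => IsCoprime.prod_right fun b _ => ?_
      rw [isCoprime_mul_unit_left_right ((Polynomial.isUnit_C.2 (isUnit_iff_ne_zero.2 hp)).pow _),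
        ← Polynomial.C_mul]
      refine Polynomial.isCoprime_X_sub_C_of_isUnit_sub (isUnit_iff_ne_zero.2 fun h => ?_)
      have hab := he a
      rw [sub_eq_zero, div_eq_iff hpn] at h
      refine hp1 (e b + 1 + n - e a) (by omega) (mul_left_cancel₀ (pow_ne_zero (e a) hp) ?_)
      rw [← pow_add, mul_one, h, show e a + (e b + 1 + n - e a) = e b + 1 + n by omega]
      ring
    refine hcop.dvd_of_dvd_mul_left ?_
    rw [hentry]
    refine Dvd.dvd.mul_right (Finset.prod_dvd_prod_of_dvd _ _ fun a _ => ?_) _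
    refine Dvd.dvd.mul_left ⟨-Polynomial.C p ^ n, ?_⟩ _
    have : Polynomial.C (p ^ e a) = Polynomial.C (p ^ e a / p ^ n) * Polynomial.C p ^ n := by
      rw [← Polynomial.C_pow, ← Polynomial.C_mul, div_mul_cancel₀ _ hpn]
    rw [this]
    ring
  have h := eval_one_of_dvd Finset.univ (fun a => p ^ e a / p ^ n) _
    (by simpa using natDegree_extendedPoly_le (n := n) m p _) hdvd
  rw [eval_extendedPoly, eval_extendedPoly, extendedLimit_zero, List.map_ofFn, List.prod_ofFn] at h
  have h0 : ∏ a, -(p ^ e a / p ^ n) ≠ 0 :=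
    Finset.prod_ne_zero_iff.2 fun a _ => neg_ne_zero.2 (div_ne_zero (pow_ne_zero _ hp) hpn)
  refine mul_right_cancel₀ h0 (h.trans ?_)
  have h2 : ∏ a, ((fun b : Fin n × F => -(b.2 * p ^ above Finset.univ b.1)) ∘
        fun a => (σ a, p ^ e a)) a * (1 - p ^ e a / p ^ n) =
      ∏ a, p ^ above Finset.univ (σ a) * (p ^ n - p ^ e a) * -(p ^ e a / p ^ n) := by
    refine Finset.prod_congr rfl fun a _ => ?_
    simp only [Function.comp]
    field_simp
  rw [Finset.prod_mul_distrib, Finset.prod_mul_distrib] at h2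
  linear_combination (∏ r ∈ Finset.range n, (1 - p ^ (r + 1))) *
    gLimit n m p (List.ofFn fun a => (σ a, p ^ e a)) * h2

/-- The additional column can be removed. -/
theorem extendedLimit_one {K : Type*} [Field K] (p : K) (m : ℕ) (σ : Fin (n * m) → Fin n)
    (e : Fin (n * m) → ℕ) (he : ∀ a, e a < n) :
    extendedLimit n m p 1 (List.ofFn fun a => (σ a, p ^ e a)) =
      (∏ r ∈ Finset.range n, (1 - p ^ (r + 1))) *
        (∏ a, p ^ above Finset.univ (σ a) * (p ^ n - p ^ e a)) *
        gLimit n m p (List.ofFn fun a => (σ a, p ^ e a)) := by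
  -- The identity is proved for an indeterminate in place of `p`, where no power is 1. Both sides
  -- are polynomials in it, so it may then be specialized, even to roots of unity.
  have hX : ∀ k, 1 ≤ k → (RatFunc.X : RatFunc K) ^ k ≠ 1 := by
    intro k hk h
    rw [← RatFunc.algebraMap_X, ← map_pow, ← map_one (algebraMap (Polynomial K) (RatFunc K))] at h
    have := congrArg Polynomial.natDegree (RatFunc.algebraMap_injective K h)
    simp at this
    omega
  have h := extendedLimit_one_of_field RatFunc.X_ne_zero hX m σ e he
  have hpoly : extendedLimit n m Polynomial.X 1
        (List.ofFn fun a => (σ a, (Polynomial.X : Polynomial K) ^ e a)) =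
      (∏ r ∈ Finset.range n, (1 - Polynomial.X ^ (r + 1))) *
        (∏ a, Polynomial.X ^ above Finset.univ (σ a) *
          (Polynomial.X ^ n - Polynomial.X ^ e a)) *
        gLimit n m Polynomial.X (List.ofFn fun a => (σ a, Polynomial.X ^ e a)) := by
    apply RatFunc.algebraMap_injective K
    rw [map_mul, map_extendedLimit, map_gLimit, List.map_ofFn]
    simpa [Function.comp_def, map_prod] using h
  have h' := congrArg (Polynomial.evalRingHom p) hpoly
  rw [map_mul, map_extendedLimit, map_gLimit, List.map_ofFn] at h'
  simpa [Function.comp_def, Polynomial.eval_prod] using h'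

end Factor

/-! ### Expansion over the arrows of a line -/

section Slots

variable {R 𝒜 ι : Type*} [CommRing R] [Ring 𝒜] [Algebra R 𝒜]

/-- The weight of a sequence of arrows whose left end carries the colours in `S`. -/
def arrowWeight (p : R) (l : List (Arrow n)) (S : Finset (Fin n)) : R :=
  match trace l with
  | none => 0
  | some T => if T.1 = S then p ^ T.2 else 0

theorem arrowWeight_nil (p : R) (S : Finset (Fin n)) :
    arrowWeight p [] S = if S = Finset.univ then 1 else 0 := by
  simp [arrowWeight, trace, eq_comm]

theorem arrowWeight_leave (p : R) (l : List (Arrow n)) (c : Fin n) (S : Finset (Fin n)) :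
    arrowWeight p (Arrow.leave c :: l) S =
      if c ∈ S then 0 else arrowWeight p l (insert c S) := by
  simp only [arrowWeight, trace]
  rcases trace l with _ | ⟨T, k⟩
  · simp
  · simp only [Option.bind_some]
    by_cases hT : c ∈ T
    · rw [if_pos hT]
      by_cases hS : c ∈ S
      · rw [if_pos hS]
        refine if_neg fun h => ?_
        rw [← h] at hS
        simp at hS
      · rw [if_neg hS]
        refine if_congr ⟨?_, ?_⟩ rfl rfl
        · rintro rfl
          exact (Finset.insert_erase hT).symm
        · rintro rfl
          exact Finset.erase_insert hS
    · rw [if_neg hT]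
      by_cases hS : c ∈ S
      · rw [if_pos hS]
      · rw [if_neg hS, if_neg]
        rintro rfl
        simp at hT

theorem arrowWeight_enter (p : R) (l : List (Arrow n)) (c : Fin n) (S : Finset (Fin n)) :
    arrowWeight p (Arrow.enter c :: l) S =
      if c ∈ S then p ^ above S c * arrowWeight p l (S.erase c) else 0 := by
  simp only [arrowWeight, trace]
  rcases trace l with _ | ⟨T, k⟩
  · simp
  · simp only [Option.bind_some]
    by_cases hT : c ∈ T
    · rw [if_pos hT]
      split_ifs with hS h
      · subst h
        simp at hT
      · simp
      · rfl
    · rw [if_neg hT]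
      change (if insert c T = S then p ^ (k + above T c) else 0) = _
      by_cases hS : c ∈ S
      · rw [if_pos hS]
        by_cases h : T = S.erase c
        · subst h
          rw [if_pos rfl, if_pos (Finset.insert_erase hS), above_erase_of_le _ le_rfl, pow_add,
            mul_comm]
        · rw [if_neg h, if_neg, mul_zero]
          rintro rfl
          exact h (Finset.erase_insert hT).symm
      · rw [if_neg hS, if_neg]
        rintro rfl
        simp at hS

/-- The sum over all colours of the leaving arrows, whose positions are labelled by `ι`; a colour
`c` leaving at position `a` contributes the operator `B c (x a)`. -/
def slotSum (p : R) (B : Fin n → R → 𝒜) (x : ι → R) : List (Fin n ⊕ ι) → Finset (Fin n) → 𝒜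
  | [], S => if S = Finset.univ then 1 else 0
  | Sum.inl c :: L, S => if c ∈ S then p ^ above S c • slotSum p B x L (S.erase c) else 0
  | Sum.inr a :: L, S => ∑ c, if c ∈ S then 0 else B c (x a) * slotSum p B x L (insert c S)

/-- The arrows obtained by giving the leaving arrows the colours in a list. -/
def fillSlots : List (Fin n ⊕ ι) → List (Fin n) → List (Arrow n)
  | Sum.inl c :: L, w => Arrow.enter c :: fillSlots L w
  | Sum.inr _ :: L, c :: w => Arrow.leave c :: fillSlots L w
  | _, _ => []

/-- Unwinding the recursion chooses the leaving colours from left to right. Once they are chosen,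
the set at the left end determines the sets along the line, so each choice carries a single weight.
This links the local moves below to the sum over `j`. -/
theorem slotSum_eq_sum (p : R) (B : Fin n → R → 𝒜) (x : ι → R) (L : List (Fin n ⊕ ι)) (N : ℕ)
    (hN : (L.filterMap Sum.getRight?).length = N) (S : Finset (Fin n)) :
    slotSum p B x L S = ∑ J : Fin N → Fin n, arrowWeight p (fillSlots L (List.ofFn J)) S •
      (List.zipWith (fun c a => B c (x a)) (List.ofFn J) (L.filterMap Sum.getRight?)).prod := by
  induction L generalizing N S with
  | nil =>
    obtain rfl : 0 = N := by simpa using hN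
    simp only [slotSum, List.filterMap_nil, Finset.univ_unique, Finset.sum_singleton, fillSlots,
      List.ofFn_zero, arrowWeight_nil, List.zipWith_nil_right, List.prod_nil]
    split_ifs <;> simp
  | cons s L ih =>
    rcases s with c | a
    · have e : (Sum.inl c :: L).filterMap Sum.getRight? = L.filterMap Sum.getRight? := rfl
      rw [e] at hN ⊢
      simp only [slotSum, fillSlots, arrowWeight_enter]
      rw [ih N hN]
      split_ifs with h
      · simp only [Finset.smul_sum, smul_smul]
      · simp
    · obtain _ | N := N
      · simp at hN
      have hN' : (L.filterMap Sum.getRight?).length = N := by simpa using hN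
      rw [← (Fin.consEquiv fun _ : Fin (N + 1) => Fin n).sum_comp, Fintype.sum_prod_type, slotSum]
      refine Finset.sum_congr rfl fun c _ => ?_
      have h1 : ∀ J : Fin N → Fin n,
          List.ofFn ((Fin.consEquiv fun _ : Fin (N + 1) => Fin n) (c, J)) = c :: List.ofFn J := by
        intro J
        rw [List.ofFn_succ]
        rfl
      simp only [h1, fillSlots, arrowWeight_leave]
      split_ifs with h
      · simp
      · rw [ih N hN', Finset.mul_sum]
        refine Finset.sum_congr rfl fun J _ => ?_
        simp

end Slots

/-! ### Absorbing and releasing operators along the line -/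

namespace ExchangeRelations

variable {R 𝒜 ι : Type*} [CommRing R] [IsDomain R] [Ring 𝒜] [Algebra R 𝒜]
  [Module.IsTorsionFree R 𝒜] {p : R} {B : Fin n → R → 𝒜}

/-- A colour `c ∉ S` leaving at parameter `p ^ k` is appended to the word of `S`. For fixed `T =
insert c S` the sum over `c ∈ T` is the longer word sum. -/
theorem sum_wordSum_mul_leave (hB : ExchangeRelations p B) (hp : p ≠ 0) (x : ι → R) {k : ℕ}
    (hk : ∀ r, 1 ≤ r → r ≤ k + 1 → 1 - p ^ r ≠ 0) {a : ι} (ha : x a = p ^ k)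
    (L : List (Fin n ⊕ ι)) :
    ∑ S with S.card = k, wordSum B (ladder p 1 k) S * slotSum p B x (Sum.inr a :: L) S =
      ∑ T with T.card = k + 1, wordSum B (ladder p 1 (k + 1)) T * slotSum p B x L T := by
  simp only [slotSum, hB.wordSum_ladder_succ hp one_ne_zero hk, Finset.sum_mul, Finset.mul_sum, ha,
    mul_one]
  rw [Finset.sum_sigma', Finset.sum_sigma']
  symm
  refine Finset.sum_bij_ne_zero (fun y _ _ => ⟨y.1.erase y.2, y.2⟩) ?_ ?_ ?_ ?_
  · rintro ⟨T, c⟩ h -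
    simp only [Finset.mem_sigma, Finset.mem_filter, Finset.mem_univ, true_and, and_true] at h ⊢
    rw [Finset.card_erase_of_mem h.2, h.1]
    rfl
  · rintro ⟨T, c⟩ h - ⟨T', c'⟩ h' - e
    simp only [Finset.mem_sigma, Finset.mem_filter, Finset.mem_univ, true_and] at h h'
    simp only [Sigma.mk.injEq, heq_eq_eq] at e ⊢
    obtain ⟨e1, rfl⟩ := e
    refine ⟨?_, rfl⟩
    rw [← Finset.insert_erase h.2, e1, Finset.insert_erase h'.2]
  · rintro ⟨S, c⟩ h hne
    simp only [Finset.mem_sigma, Finset.mem_filter, Finset.mem_univ, true_and, and_true] at h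
    have hc : c ∉ S := fun hc => hne (by simp [hc])
    have e : (insert c S).erase c = S := Finset.erase_insert hc
    refine ⟨⟨insert c S, c⟩, ?_, ?_, ?_⟩
    · simp [hc, h]
    · simp only [if_neg hc] at hne
      rw [e, mul_assoc]
      exact hne
    · rw [e]
  · rintro ⟨T, c⟩ h -
    simp only [Finset.mem_sigma, Finset.mem_filter, Finset.mem_univ, true_and] at h
    simp [Finset.insert_erase h.2, mul_assoc]

/-- The weight `p ^ above S i` of the arrow is precisely the one in the fusion identity, which
releases `B i (p ^ k)` to the left. -/
theorem sum_wordSum_mul_enter (hB : ExchangeRelations p B) (hp : p ≠ 0)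
    (hpn : ∀ r, 1 ≤ r → r ≤ n → 1 - p ^ r ≠ 0) (x : ι → R) {k : ℕ} (hk : k + 1 ≤ n) (i : Fin n)
    (L : List (Fin n ⊕ ι)) :
    ∑ S with S.card = k + 1, wordSum B (ladder p 1 (k + 1)) S * slotSum p B x (Sum.inl i :: L) S =
      (∑ r ∈ Finset.range (k + 1), p ^ r) •
        (B i (p ^ k) * ∑ T with T.card = k, wordSum B (ladder p 1 k) T * slotSum p B x L T) := by
  have hp1 : 1 - p ≠ 0 := by simpa using hpn 1 le_rfl (by omega)
  rw [Finset.mul_sum, Finset.smul_sum]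
  refine Finset.sum_bij_ne_zero (fun S _ _ => S.erase i) ?_ ?_ ?_ ?_
  · intro S h hne
    have hi : i ∈ S := by
      by_contra hi
      exact hne (by simp [slotSum, hi])
    simp only [Finset.mem_filter, Finset.mem_univ, true_and] at h ⊢
    rw [Finset.card_erase_of_mem hi, h]
    rfl
  · intro S h hne S' h' hne' e
    have hi : i ∈ S := by
      by_contra hi
      exact hne (by simp [slotSum, hi])
    have hi' : i ∈ S' := by
      by_contra hi
      exact hne' (by simp [slotSum, hi])
    rw [← Finset.insert_erase hi, e, Finset.insert_erase hi']
  · intro T h hne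
    simp only [Finset.mem_filter, Finset.mem_univ, true_and] at h
    -- Sets `T` that already contain `i` do not come from any `S`; on the right side their terms
    -- vanish by `mul_wordSum_ladder_eq_zero`.
    have hi : i ∉ T := by
      intro hi
      have hk1 : 1 ≤ k := h ▸ Finset.card_pos.2 ⟨i, hi⟩
      have h0 := hB.mul_wordSum_ladder_eq_zero hp hp1 (hpn 2 (by omega) (by omega)) one_ne_zero h hi
      rw [mul_one] at h0
      exact hne (by rw [← mul_assoc, h0, zero_mul, smul_zero])
    have hcard : (insert i T).card = k + 1 := by rw [Finset.card_insert_of_notMem hi, h]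
    have h1 := hB.smul_wordSum_ladder hp hp1 one_ne_zero hcard (Finset.mem_insert_self i T)
    rw [mul_one, Finset.erase_insert hi] at h1
    refine ⟨insert i T, by simpa using hcard, ?_, Finset.erase_insert hi⟩
    rw [slotSum, if_pos (Finset.mem_insert_self i T), mul_smul_comm, ← smul_mul_assoc, ← h1,
      Finset.erase_insert hi, smul_mul_assoc, mul_assoc]
    exact hne
  · intro S h hne
    have hi : i ∈ S := by
      by_contra hi
      exact hne (by simp [slotSum, hi])
    simp only [Finset.mem_filter, Finset.mem_univ, true_and] at h
    have h1 := hB.smul_wordSum_ladder hp hp1 one_ne_zero h hi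
    rw [mul_one] at h1
    rw [slotSum, if_pos hi, mul_smul_comm, ← smul_mul_assoc, ← h1, smul_mul_assoc, mul_assoc]

theorem sum_wordSum_mul_bundle (hB : ExchangeRelations p B) (hp : p ≠ 0)
    (hpn : ∀ r, 1 ≤ r → r ≤ n → 1 - p ^ r ≠ 0) (x : ι → R) {k : ℕ} (hk : k + 1 ≤ n) {κ : Type*}
    (us : List κ) (c : κ → Fin n) (a : κ → ι) (ha : ∀ u, x (a u) = p ^ k)
    (L : List (Fin n ⊕ ι)) :
    ∑ S with S.card = k + 1, wordSum B (ladder p 1 (k + 1)) S *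
        slotSum p B x ((us.flatMap fun u => [Sum.inl (c u), Sum.inr (a u)]) ++ L) S =
      (∑ r ∈ Finset.range (k + 1), p ^ r) ^ us.length •
        ((us.map fun u => B (c u) (p ^ k)).prod *
          ∑ T with T.card = k + 1, wordSum B (ladder p 1 (k + 1)) T * slotSum p B x L T) := by
  induction us with
  | nil => simp
  | cons u us ih =>
    simp only [List.flatMap_cons, List.cons_append, List.nil_append, List.map_cons, List.prod_cons,
      List.length_cons]
    rw [hB.sum_wordSum_mul_enter hp hpn x hk, hB.sum_wordSum_mul_leave hp x
      (fun r h1 h2 => hpn r h1 (h2.trans hk)) (ha u), ih, pow_succ', mul_smul, mul_assoc,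
      mul_smul_comm]

/-- Inside a bundle, entering and leaving arrows alternate and the size of the set returns to its
value. The additional leaving arrow at its left end raises the size by one from bundle to bundle, in
step with the exponent of the parameter, until all `n` colours are present at the right end. -/
theorem sum_wordSum_mul_line (hB : ExchangeRelations p B) (hp : p ≠ 0)
    (hpn : ∀ r, 1 ≤ r → r ≤ n → 1 - p ^ r ≠ 0) (x : ι → R) (m d k : ℕ) (hk : k + d = n)
    (c : Fin d → Fin m → Fin n) (a : Fin d → Fin (m + 1) → ι)
    (ha : ∀ s u, x (a s u) = p ^ (k + s)) :
    ∑ S with S.card = k, wordSum B (ladder p 1 k) S *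
        slotSum p B x ((List.finRange d).flatMap fun s => Sum.inr (a s 0) ::
          (List.finRange m).flatMap fun u => [Sum.inl (c s u), Sum.inr (a s u.succ)]) S =
      (∏ s : Fin d, (∑ r ∈ Finset.range (k + s + 1), p ^ r) ^ m) •
        (((List.finRange d).map fun s =>
            ((List.finRange m).map fun u => B (c s u) (p ^ (k + s))).prod).prod *
          wordSum B (ladder p 1 n) Finset.univ) := by
  induction d generalizing k with
  | zero =>
    obtain rfl : k = n := hk
    rw [Finset.sum_eq_single Finset.univ]
    · simp [slotSum]
    · intro S _ hS
      simp [slotSum, hS]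
    · simp
  | succ d ih =>
    have ih' := ih (k + 1) (by omega) (fun s => c s.succ) (fun s => a s.succ) fun s u => by
      rw [ha]
      simp only [Fin.val_succ]
      congr 1
      omega
    rw [List.finRange_succ, List.flatMap_cons, List.cons_append, List.flatMap_map,
      hB.sum_wordSum_mul_leave hp x (fun r h1 h2 => hpn r h1 (h2.trans (by omega)))
        (by simpa using ha 0 0), hB.sum_wordSum_mul_bundle hp hpn x (by omega) _ _ _
        (fun u => by simpa using ha 0 u.succ), ih', Fin.prod_univ_succ, List.map_cons,
      List.prod_cons, List.map_map, mul_smul_comm, smul_smul, mul_assoc]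
    simp only [List.length_finRange, Fin.val_zero, add_zero, Fin.val_succ, Function.comp_def,
      add_comm, add_left_comm]

end ExchangeRelations

/-! ### The line of a pair of colour sequences -/

section Line

/-- The line of a colour sequence `i`, with labelled leaving arrows in place of coloured ones. -/
def lineSlots {m : ℕ} (i : Fin (n * m) → Fin n) : List (Fin n ⊕ Fin (n * (m + 1))) :=
  (List.finRange n).flatMap fun k => Sum.inr (finProdFinEquiv (k, 0)) ::
    (List.finRange m).flatMap fun a =>
      [Sum.inl (i (finProdFinEquiv (k, a))), Sum.inr (finProdFinEquiv (k, a.succ))]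

theorem fillSlots_map {ι : Type*} (L : List (Fin n ⊕ ι)) (J : ι → Fin n) :
    fillSlots L ((L.filterMap Sum.getRight?).map J) =
      L.map (Sum.elim Arrow.enter fun a => Arrow.leave (J a)) := by
  induction L with
  | nil => rfl
  | cons s L ih =>
    rcases s with c | a
    · exact congrArg (Arrow.enter c :: ·) ih
    · exact congrArg (Arrow.leave (J a) :: ·) ih

theorem finProdFinEquiv_div {m : ℕ} (k : Fin n) (b : Fin m) :
    (finProdFinEquiv (k, b) : ℕ) / m = k := by
  have := b.pos
  simp [finProdFinEquiv, Nat.add_mul_div_left, this]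

theorem flatMap_finRange (n m : ℕ) :
    ((List.finRange n).flatMap fun k => (List.finRange m).map fun b => finProdFinEquiv (k, b)) =
      List.finRange (n * m) := by
  have h := List.ofFn_mul (m := n) (n := m) (fun a : Fin (n * m) => a)
  rw [List.ofFn_eq_map, List.map_id', List.ofFn_eq_map, ← List.flatMap_def] at h
  rw [h]
  congr 1
  funext k
  rw [List.ofFn_eq_map]
  refine List.map_congr_left fun b _ => Fin.ext ?_
  simp [finProdFinEquiv, add_comm, mul_comm]

theorem filterMap_getRight_lineSlots {m : ℕ} (i : Fin (n * m) → Fin n) :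
    (lineSlots i).filterMap Sum.getRight? = List.finRange (n * (m + 1)) := by
  rw [← flatMap_finRange, lineSlots, List.filterMap_flatMap]
  congr 1
  funext k
  rw [List.finRange_succ, List.map_cons, List.map_map]
  have h : ∀ l : List (Fin m), (l.flatMap fun a =>
      [(Sum.inl (i (finProdFinEquiv (k, a))) : Fin n ⊕ Fin (n * (m + 1))),
        Sum.inr (finProdFinEquiv (k, a.succ))]).filterMap Sum.getRight? =
      l.map ((fun b => finProdFinEquiv (k, b)) ∘ Fin.succ) := by
    intro l
    induction l with
    | nil => rfl
    | cons a l ih => exact congrArg (finProdFinEquiv (k, a.succ) :: ·) ih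
  rw [← h]
  rfl

theorem filterMap_getLeft_lineSlots {m : ℕ} (i : Fin (n * m) → Fin n) :
    (lineSlots i).filterMap Sum.getLeft? = List.ofFn i := by
  rw [List.ofFn_eq_map, ← flatMap_finRange, lineSlots, List.filterMap_flatMap, List.map_flatMap]
  congr 1
  funext k
  have h : ∀ l : List (Fin m), (l.flatMap fun a =>
      [(Sum.inl (i (finProdFinEquiv (k, a))) : Fin n ⊕ Fin (n * (m + 1))),
        Sum.inr (finProdFinEquiv (k, a.succ))]).filterMap Sum.getLeft? =
      (l.map fun b => finProdFinEquiv (k, b)).map i := by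
    intro l
    induction l with
    | nil => rfl
    | cons a l ih => exact congrArg (i (finProdFinEquiv (k, a)) :: ·) ih
  rw [← h]
  rfl

theorem arrows_eq_fillSlots {m : ℕ} (i : Fin (n * m) → Fin n) (j : Fin (n * (m + 1)) → Fin n) :
    arrows i j = fillSlots (lineSlots i) (List.ofFn j) := by
  rw [List.ofFn_eq_map, ← filterMap_getRight_lineSlots i, fillSlots_map, lineSlots,
    List.map_flatMap, arrows]
  simp [List.map_flatMap]

/-- Balance of the colour `c`: the summand 1 is the path that starts at the right end of the line.
-/
theorem count_of_trace_eq_some {ι : Type*} (L : List (Fin n ⊕ ι)) (w : List (Fin n))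
    (hw : w.length = (L.filterMap Sum.getRight?).length) (T : Finset (Fin n)) (k : ℕ)
    (h : trace (fillSlots L w) = some (T, k)) (c : Fin n) :
    (L.filterMap Sum.getLeft?).count c + 1 = w.count c + if c ∈ T then 1 else 0 := by
  induction L generalizing w T k with
  | nil =>
    obtain rfl : w = [] := by simpa using hw
    simp only [fillSlots, trace, Option.some.injEq, Prod.mk.injEq] at h
    simp [← h.1]
  | cons s L ih =>
    rcases s with d | a
    · have e : (Sum.inl d :: L).filterMap Sum.getLeft? = d :: L.filterMap Sum.getLeft? := rfl
      have e' : (Sum.inl d :: L).filterMap Sum.getRight? = L.filterMap Sum.getRight? := rfl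
      rw [e'] at hw
      simp only [fillSlots, trace, Option.bind_eq_some_iff] at h
      obtain ⟨⟨T', k'⟩, h1, h2⟩ := h
      have := ih w hw T' k' h1
      simp only [Option.ite_none_left_eq_some, Option.some.injEq, Prod.mk.injEq] at h2
      obtain ⟨hd, rfl, -⟩ := h2
      rw [e, List.count_cons]
      by_cases hc : d = c
      · subst hc
        simp [hd] at this ⊢
        omega
      · have hc' : c ≠ d := Ne.symm hc
        simpa [hc, hc'] using this
    · obtain _ | ⟨d, w⟩ := w
      · simp at hw
      have hw' : w.length = (L.filterMap Sum.getRight?).length := by simpa using hw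
      simp only [fillSlots, trace, Option.bind_eq_some_iff] at h
      obtain ⟨⟨T', k'⟩, h1, h2⟩ := h
      have := ih w hw' T' k' h1
      simp only [Option.ite_none_right_eq_some, Option.some.injEq, Prod.mk.injEq] at h2
      obtain ⟨hd, rfl, -⟩ := h2
      have e : (Sum.inr a :: L).filterMap Sum.getLeft? = L.filterMap Sum.getLeft? := rfl
      rw [e, List.count_cons]
      by_cases hc : d = c
      · subst hc
        simp [hd] at this ⊢
        omega
      · have hc' : c ≠ d := Ne.symm hc
        simpa [hc, hc'] using this

theorem count_ofFn {N : ℕ} (f : Fin N → Fin n) (c : Fin n) :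
    (List.ofFn f).count c = (Finset.univ.filter fun a => f a = c).card := by
  induction N with
  | zero => simp
  | succ N ih =>
    rw [List.ofFn_succ, List.count_cons, ih, Fin.card_filter_univ_succ]
    by_cases h : f 0 = c <;> simp [h]

theorem isColourSeq_of_arrowWeight_ne_zero {R : Type*} [CommRing R] (p : R) {m : ℕ}
    {i : Fin (n * m) → Fin n} (hi : IsColourSeq m i) {j : Fin (n * (m + 1)) → Fin n}
    (h : arrowWeight p (arrows i j) ∅ ≠ 0) : IsColourSeq (m + 1) j := by
  intro c
  rw [arrowWeight, arrows_eq_fillSlots] at h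
  rcases ht : trace (fillSlots (lineSlots i) (List.ofFn j)) with _ | ⟨T, k⟩
  · simp [ht] at h
  · have hT : T = ∅ := by
      by_contra hT
      simp [ht, hT] at h
    have := count_of_trace_eq_some (lineSlots i) (List.ofFn j)
      (by rw [filterMap_getRight_lineSlots]; simp) T k ht c
    rw [filterMap_getLeft_lineSlots, count_ofFn, count_ofFn, hi c, hT] at this
    simpa using this.symm

/-- The operator identity along the line, read off at the entry from the full to the empty state.
Starting with no colour on the line makes the initial word sum trivial. -/
theorem sum_arrowWeight_mul_gLimit {K : Type*} [Field K] {p : K} (hp : p ≠ 0)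
    (hpn : ∀ r, 1 ≤ r → r ≤ n → 1 - p ^ r ≠ 0) (m : ℕ) (i : Fin (n * m) → Fin n) :
    ∑ j : Fin (n * (m + 1)) → Fin n, arrowWeight p (arrows i j) ∅ *
        gLimit n (m + 1) p (List.ofFn fun a => (j a, p ^ ((a : ℕ) / (m + 1)))) =
      (∏ s : Fin n, (∑ r ∈ Finset.range (s + 1), p ^ r) ^ m) *
        extendedLimit n m p 1 (List.ofFn fun a => (i a, p ^ ((a : ℕ) / m))) := by
  have key := (zeroRow_exchangeRelations (n := n) hp (m + 1)).sum_wordSum_mul_line hp hpn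
    (fun a : Fin (n * (m + 1)) => p ^ ((a : ℕ) / (m + 1))) m n 0 (zero_add n)
    (fun s u => i (finProdFinEquiv (s, u))) (fun s u => finProdFinEquiv (s, u))
    (fun s u => by rw [finProdFinEquiv_div, zero_add])
  rw [Finset.sum_eq_single ∅ (fun S h hS => absurd (Finset.card_eq_zero.1 (by simpa using h)) hS)
    (by simp), ladder, wordSum, if_pos rfl, one_mul] at key
  have key' := (slotSum_eq_sum p (fun i x => zeroRow p (m + 1) x (some i) none)
    (fun a : Fin (n * (m + 1)) => p ^ ((a : ℕ) / (m + 1))) (lineSlots i) (n * (m + 1))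
    (by rw [filterMap_getRight_lineSlots]; simp) ∅).symm.trans key
  have hentry := congrFun (congrFun key' (fun _ => Finset.univ)) (fun _ => ∅)
  rw [Matrix.sum_apply, Matrix.smul_apply] at hentry
  have hL : ∀ j : Fin (n * (m + 1)) → Fin n,
      List.zipWith (fun c (a : Fin (n * (m + 1))) =>
          zeroRow p (m + 1) (p ^ ((a : ℕ) / (m + 1))) (some c) none)
        (List.ofFn j) ((lineSlots i).filterMap Sum.getRight?) =
      (List.ofFn fun a => (j a, p ^ ((a : ℕ) / (m + 1)))).map
        fun b => zeroRow p (m + 1) b.2 (some b.1) none := by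
    intro j
    rw [filterMap_getRight_lineSlots, List.ofFn_eq_map, List.ofFn_eq_map, List.map_map]
    induction List.finRange (n * (m + 1)) with
    | nil => rfl
    | cons a l ih => rw [List.map_cons, List.zipWith_cons_cons, ih]; rfl
  have hR : ((List.finRange n).map fun s : Fin n => ((List.finRange m).map fun u =>
        zeroRow p (m + 1) (p ^ (0 + (s : ℕ))) (some (i (finProdFinEquiv (s, u)))) none).prod).prod =
      ((List.ofFn fun a => (i a, p ^ ((a : ℕ) / m))).map
        fun b => zeroRow p (m + 1) b.2 (some b.1) none).prod := by
    rw [List.ofFn_eq_map, List.map_map, ← flatMap_finRange, List.map_flatMap, List.flatMap_def,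
      List.prod_flatten, List.map_map]
    congr 1
    refine List.map_congr_left fun s _ => ?_
    rw [Function.comp, List.map_map]
    congr 1
    refine List.map_congr_left fun u _ => ?_
    simp only [Function.comp, finProdFinEquiv_div, zero_add]
  rw [hR] at hentry
  simp only [zero_add, smul_eq_mul] at hentry
  rw [extendedLimit, ← hentry]
  refine Finset.sum_congr rfl fun j _ => ?_
  rw [hL, ← arrows_eq_fillSlots, Matrix.smul_apply, gLimit, smul_eq_mul]

end Line

/-! ### Specialization and constants -/

section Constants

theorem above_univ (c : Fin n) : above Finset.univ c = n - 1 - c := by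
  have : (Finset.univ.filter fun a => c < a) = Finset.Ioi c := by ext; simp
  rw [above, this, Fin.card_Ioi]

theorem prod_div {M : Type*} [CommMonoid M] (n m : ℕ) (f : ℕ → M) :
    ∏ a : Fin (n * m), f ((a : ℕ) / m) = (∏ k ∈ Finset.range n, f k) ^ m := by
  rw [← finProdFinEquiv.prod_comp, Fintype.prod_prod_type, ← Fin.prod_univ_eq_prod_range,
    ← Finset.prod_pow]
  refine Finset.prod_congr rfl fun k _ => ?_
  simp only [finProdFinEquiv_div, Finset.prod_const, Finset.card_univ, Fintype.card_fin]

theorem prod_colourSeq {M : Type*} [CommMonoid M] {m : ℕ} {i : Fin (n * m) → Fin n}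
    (hi : IsColourSeq m i) (f : Fin n → M) : ∏ a, f (i a) = (∏ c, f c) ^ m := by
  rw [← Finset.prod_fiberwise' Finset.univ i, ← Finset.prod_pow]
  refine Finset.prod_congr rfl fun c _ => ?_
  rw [Finset.prod_const, hi c]

variable {K : Type*} [Field K]

theorem prod_geom_sum_mul (p : K) (n m : ℕ) :
    (∏ s : Fin n, (∑ r ∈ Finset.range (s + 1), p ^ r) ^ m) * (1 - p) ^ (n * m) =
      (∏ r ∈ Finset.range n, (1 - p ^ (r + 1))) ^ m := by
  rw [Fin.prod_univ_eq_prod_range (fun s => (∑ r ∈ Finset.range (s + 1), p ^ r) ^ m),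
    Finset.prod_pow, pow_mul, ← mul_pow]
  congr 1
  rw [← Finset.card_range n, ← Finset.prod_const, Finset.card_range, ← Finset.prod_mul_distrib]
  exact Finset.prod_congr rfl fun s _ => geom_sum_mul_neg p (s + 1)

theorem prod_pow_sub_pow (p : K) (n : ℕ) :
    ∏ k ∈ Finset.range n, (p ^ n - p ^ k) = (-1) ^ n * (∏ k ∈ Finset.range n, p ^ k) *
      ∏ r ∈ Finset.range n, (1 - p ^ (r + 1)) := by
  have h : ((-1 : K)) ^ n = ∏ k ∈ Finset.range n, (-1 : K) := by simp
  rw [← Finset.prod_range_reflect (fun r => 1 - p ^ (r + 1)), h, ← Finset.prod_mul_distrib,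
    ← Finset.prod_mul_distrib]
  refine Finset.prod_congr rfl fun k hk => ?_
  have hk := Finset.mem_range.1 hk
  have : p ^ n = p ^ k * p ^ (n - 1 - k + 1) := by
    rw [← pow_add]
    congr 1
    omega
  rw [this]
  ring

theorem prod_pow_above (p : K) {m : ℕ} {i : Fin (n * m) → Fin n} (hi : IsColourSeq m i) :
    ∏ a, p ^ above Finset.univ (i a) = (∏ k ∈ Finset.range n, p ^ k) ^ m := by
  rw [prod_colourSeq hi fun c => p ^ above Finset.univ c]
  simp only [above_univ]
  rw [Fin.prod_univ_eq_prod_range (fun c => p ^ (n - 1 - c)),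
    Finset.prod_range_reflect (fun c => p ^ c)]

theorem sq_prod_range_pow (p : K) (n : ℕ) :
    (∏ k ∈ Finset.range n, p ^ k) * ∏ k ∈ Finset.range n, p ^ k = p ^ ((n - 1) * n) := by
  rw [Finset.prod_pow_eq_pow_sum, ← pow_add, ← mul_two, Finset.sum_range_id_mul_two, mul_comm]

/-- Needed to pass from the parameters `q ^ (n - 1 - k)` to `q⁻¹ ^ k`, which form the progression
starting at 1. -/
theorem gLimit_scale {R : Type*} [CommRing R] (m : ℕ) (p r : R) {N : ℕ} (σ : Fin N → Fin n)
    (x : Fin N → R) : gLimit n m p (List.ofFn fun a => (σ a, r * x a)) =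
      r ^ (n * ∑ k ∈ Finset.range m, k) * gLimit n m p (List.ofFn fun a => (σ a, x a)) := by
  have h := prod_zeroRow_mul p r m (List.ofFn fun a => (σ a, x a)) Prod.snd
    (fun b => some b.1) (fun _ => (Finset.univ : Finset (Fin n))) (fun _ => ∅)
  have h0 : position 0 (fun _ : Fin m => (∅ : Finset (Fin n))) = 0 := by simp [position]
  have h1 : position 0 (fun _ : Fin m => (Finset.univ : Finset (Fin n))) =
      n * ∑ k ∈ Finset.range m, k := by
    rw [position, ← Fin.sum_univ_eq_sum_range (fun k => k), Finset.mul_sum]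
    exact Finset.sum_congr rfl fun k _ => by simp [mul_comm]
  rw [h0, h1, pow_zero, one_mul] at h
  rw [gLimit, gLimit, ← h]
  rw [List.map_ofFn, List.map_ofFn]
  rfl

theorem pow_choose_sub (q : K) (n m : ℕ) :
    q ^ ((n * m + n + 1).choose 2 - (n * m + 1).choose 2) * q ^ (n * m) =
      (∏ r ∈ Finset.range n, q ^ (r + 1)) ^ (2 * m + 1) := by
  rw [Finset.prod_pow_eq_pow_sum, ← pow_mul, ← pow_add]
  congr 1
  have h1 : ∑ r ∈ Finset.range n, (r + 1) = (n + 1).choose 2 := by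
    induction n with
    | zero => rfl
    | succ n ih => rw [Finset.sum_range_succ, ih, Nat.choose_succ_succ' (n + 1) 1]; simp; omega
  have h2 : (n * m + n + 1).choose 2 =
      (n * m + 1).choose 2 + (n * (n * m) + (n + 1).choose 2) := by
    clear h1
    generalize n * m = N
    induction n with
    | zero => simp
    | succ n ih =>
      rw [show N + (n + 1) + 1 = (N + n + 1) + 1 by ring, Nat.choose_succ_succ' (N + n + 1) 1, ih,
        Nat.choose_succ_succ' (n + 1) 1]
      simp
      ring
  have h3 : 2 * (n + 1).choose 2 = n * (n + 1) := by
    rw [Nat.choose_two_right, Nat.add_sub_cancel, mul_comm (n + 1),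
      Nat.mul_div_cancel' (Nat.even_mul_succ_self n).two_dvd]
  rw [h1, h2, Nat.add_sub_cancel_left]
  have h4 : m * (2 * (n + 1).choose 2) = m * (n * (n + 1)) := by rw [h3]
  linarith

theorem prod_one_sub_inv_pow {q : K} (hq : q ≠ 0) (n : ℕ) :
    (∏ r ∈ Finset.range n, q ^ (r + 1)) * ∏ r ∈ Finset.range n, (1 - q⁻¹ ^ (r + 1)) =
      (-1) ^ n * qPoch q q n := by
  have h : ((-1 : K)) ^ n = ∏ k ∈ Finset.range n, (-1 : K) := by simp
  rw [qPoch, h, ← Finset.prod_mul_distrib, ← Finset.prod_mul_distrib]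
  refine Finset.prod_congr rfl fun r _ => ?_
  rw [inv_pow, mul_sub, mul_inv_cancel₀ (pow_ne_zero _ hq)]
  ring

theorem qSpec_eq {q : K} (hq : q ≠ 0) (m : ℕ) (a : Fin (n * m)) :
    qSpec q n m a = q ^ (n - 1) * q⁻¹ ^ ((a : ℕ) / m) := by
  have h : (a : ℕ) / m < n := Nat.div_lt_of_lt_mul (a.2.trans_eq (mul_comm n m))
  rw [qSpec, inv_pow, eq_mul_inv_iff_mul_eq₀ (pow_ne_zero _ hq), ← pow_add]
  generalize (a : ℕ) / m = k at h ⊢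
  congr 1
  omega

theorem gRat_qSpec {q : K} (hq : q ≠ 0) (hn : 1 ≤ n) (m : ℕ) (σ : Fin (n * m) → Fin n) :
    (gRat q (delta n m) σ (qSpec q n m)).denom.eval 0 ≠ 0 ∧
    gZero q (delta n m) σ (qSpec q n m) = (q ^ (n - 1)) ^ (n * ∑ k ∈ Finset.range m, k) *
      gLimit n m q⁻¹ (List.ofFn fun a => (σ a, q⁻¹ ^ ((a : ℕ) / m))) := by
  obtain ⟨h1, h2⟩ := gRat_delta_mem_regularGraph q m hn σ (qSpec q n m)
    fun a => pow_ne_zero _ hq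
  refine ⟨h1, ?_⟩
  rw [← gLimit_scale]
  simp only [← qSpec_eq hq]
  exact h2

/-- The coefficients of the expansion multiply to one. -/
theorem constant_identity {q : K} (hq0 : q ≠ 0) (hq : ∀ k : ℕ, 1 ≤ k → k ≤ n → q ^ k ≠ 1)
    (hn : 1 ≤ n) {m : ℕ} {i : Fin (n * m) → Fin n} (hi : IsColourSeq m i) :
    (-1) ^ n * q ^ ((n * m + n + 1).choose 2 - (n * m + 1).choose 2) *
      ((1 - q) ^ (n * m) / qPoch q q n ^ (2 * m + 1)) *
      ((q ^ (n - 1)) ^ (n * m) * ((∏ s : Fin n, (∑ r ∈ Finset.range (s + 1), q⁻¹ ^ r) ^ m) *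
        ((∏ r ∈ Finset.range n, (1 - q⁻¹ ^ (r + 1))) *
          ∏ a : Fin (n * m), q⁻¹ ^ above Finset.univ (i a) *
            (q⁻¹ ^ n - q⁻¹ ^ ((a : ℕ) / m))))) = 1 := by
  have hQ : qPoch q q n ≠ 0 := by
    refine Finset.prod_ne_zero_iff.2 fun r hr => sub_ne_zero.2 fun h => ?_
    refine hq (r + 1) (by omega) (Finset.mem_range.1 hr) ?_
    rw [pow_succ', ← h]
  have h1q : (1 : K) - q⁻¹ ≠ 0 := sub_ne_zero.2 fun h => by
    refine hq 1 le_rfl hn ?_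
    rw [pow_one, ← inv_inv q, ← h, inv_one]
  rw [Finset.prod_mul_distrib, prod_pow_above _ hi, prod_div n m (fun k => q⁻¹ ^ n - q⁻¹ ^ k),
    prod_pow_sub_pow]
  have e1 := prod_geom_sum_mul q⁻¹ n m
  have e2 := sq_prod_range_pow q⁻¹ n
  have e3 := pow_choose_sub q n m
  have e4 := prod_one_sub_inv_pow hq0 n
  have e5 : (1 - q) ^ (n * m) = (-1) ^ (n * m) * (1 - q⁻¹) ^ (n * m) * q ^ (n * m) := by
    rw [← mul_pow, ← mul_pow]
    congr 1
    field_simp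
    ring
  have e6 : (q ^ (n - 1)) ^ (n * m) * (q⁻¹ ^ ((n - 1) * n)) ^ m = 1 := by
    rw [← pow_mul, ← pow_mul, mul_assoc (n - 1), ← mul_pow, mul_inv_cancel₀ hq0, one_pow]
  have hsign : ∀ k : ℕ, ((-1 : K) ^ k) * (-1) ^ k = 1 := fun k => by
    rw [← mul_pow]; simp
  rw [e5]
  set G := ∏ s : Fin n, (∑ r ∈ Finset.range (s + 1), q⁻¹ ^ r) ^ m
  set P := ∏ r ∈ Finset.range n, (1 - q⁻¹ ^ (r + 1))
  set D := ∏ r ∈ Finset.range n, q ^ (r + 1)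
  set U := ∏ k ∈ Finset.range n, q⁻¹ ^ k
  rw [← e2] at e6
  set E := (n * m + n + 1).choose 2 - (n * m + 1).choose 2
  -- The exponent is odd, so one sign `(-1) ^ n` survives; it cancels the sign in `Theta`.
  have e7 : (D * P) ^ (2 * m + 1) = (-1) ^ n * qPoch q q n ^ (2 * m + 1) := by
    rw [e4, mul_pow, pow_succ ((-1) ^ n), pow_mul, sq, hsign, one_pow, one_mul]
  calc _ = ((-1) ^ n * (q ^ E * q ^ (n * m)) * (((-1) ^ (n * m) * (-1) ^ (n * m))) *
        (G * (1 - q⁻¹) ^ (n * m)) * ((q ^ (n - 1)) ^ (n * m) * (U * U) ^ m) * P * P ^ m) /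
        qPoch q q n ^ (2 * m + 1) := by
        rw [mul_pow, mul_pow, mul_pow, ← pow_mul]
        ring
    _ = 1 := by
        rw [e1, e3, e6, hsign, div_eq_one_iff_eq (pow_ne_zero _ hQ)]
        have := hsign n
        linear_combination (-1) ^ n * e7 + qPoch q q n ^ (2 * m + 1) * this

end Constants
end FermionicVertex

/-! ### Proof of the theorem -/

open FermionicVertex in
theorem theorem7p2 {K : Type*} [Field K] (q : K) (n m : ℕ) (hn : 1 ≤ n) (hm : 1 ≤ m)
    (hq0 : q ≠ 0) (hq : ∀ k : ℕ, 1 ≤ k → k ≤ n → q ^ k ≠ 1)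
    (i : Fin (n * m) → Fin n) (hi : IsColourSeq m i) :
    (gRat q (delta n m) i (qSpec q n m)).denom.eval 0 ≠ 0 ∧
    (∀ j : Fin (n * (m + 1)) → Fin n, IsColourSeq (m + 1) j →
      (gRat q (delta n (m + 1)) j (qSpec q n (m + 1))).denom.eval 0 ≠ 0) ∧
    gZero q (delta n m) i (qSpec q n m) =
      ∑ j : Fin (n * (m + 1)) → Fin n with IsColourSeq (m + 1) j,
        Theta q i j * gZero q (delta n (m + 1)) j (qSpec q n (m + 1)) := by
  refine ⟨(gRat_qSpec hq0 hn m i).1, fun j _ => (gRat_qSpec hq0 hn (m + 1) j).1, ?_⟩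
  -- The indicator of interlacing is redundant, since the weight already vanishes when the line is
  -- not admissible.
  have hTheta : ∀ j : Fin (n * (m + 1)) → Fin n, Theta q i j =
      (-1) ^ n * q ^ ((n * m + n + 1).choose 2 - (n * m + 1).choose 2) *
        ((1 - q) ^ (n * m) / qPoch q q n ^ (2 * m + 1)) * arrowWeight q⁻¹ (arrows i j) ∅ := by
    intro j
    have hPsi : Psi q⁻¹ i j = arrowWeight q⁻¹ (arrows i j) ∅ := rfl
    rw [Theta, hPsi]
    split_ifs with h
    · rw [one_mul]
    · have h0 : arrowWeight q⁻¹ (arrows i j) ∅ = 0 := by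
        unfold arrowWeight
        rcases ht : trace (arrows i j) with _ | ⟨T, k⟩
        · rfl
        · refine if_neg fun hT => h ⟨k, ?_⟩
          rw [ht]
          exact congrArg (fun T => some (T, k)) hT
      rw [h0, mul_zero, mul_zero]
  have hp : ∀ r, 1 ≤ r → r ≤ n → 1 - q⁻¹ ^ r ≠ 0 := fun r h1 h2 => sub_ne_zero.2 fun h => by
    refine hq r h1 h2 ?_
    rw [inv_pow] at h
    rw [← inv_inv (q ^ r), ← h, inv_one]
  have hlt : ∀ a : Fin (n * m), (a : ℕ) / m < n := fun a =>
    Nat.div_lt_of_lt_mul (a.2.trans_eq (mul_comm n m))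
  have key := sum_arrowWeight_mul_gLimit (inv_ne_zero hq0) hp m i
  rw [extendedLimit_one q⁻¹ m i (fun a => (a : ℕ) / m) hlt] at key
  -- The restriction to colour sequences can be dropped, because by colour balance all other `j`
  -- have weight 0.
  rw [Finset.sum_filter_of_ne fun j _ hne => isColourSeq_of_arrowWeight_ne_zero q⁻¹ hi
    fun h0 => hne (by rw [hTheta, h0, mul_zero, zero_mul]), (gRat_qSpec hq0 hn m i).2]
  have hc := constant_identity hq0 hq hn hi
  -- The scaling factors of levels `m + 1` and `m` differ by `(q ^ (n - 1)) ^ (n * m)`, the factor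
  -- included in `constant_identity`.
  have hr : (q ^ (n - 1)) ^ (n * ∑ k ∈ Finset.range (m + 1), k) =
      (q ^ (n - 1)) ^ (n * ∑ k ∈ Finset.range m, k) * (q ^ (n - 1)) ^ (n * m) := by
    rw [Finset.sum_range_succ, mul_add, pow_add]
  simp_rw [hTheta, (gRat_qSpec hq0 hn (m + 1) _).2, hr,
    mul_mul_mul_comm _ (arrowWeight _ _ _)]
  rw [← Finset.mul_sum, key]
  linear_combination (-((q ^ (n - 1)) ^ (n * ∑ k ∈ Finset.range m, k) *
    gLimit n m q⁻¹ (List.ofFn fun a => (i a, q⁻¹ ^ ((a : ℕ) / m))))) * hc
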